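/- Let $\alpha,\delta\in\mathbb R$, $\beta>0$, $s\in\mathbb R$, and let $(\mu,r)$ be a pair of exponents with $$2\le \mu,r\le\infty,\qquad \frac3\mu+\frac1r=\frac12$$ (where $1/\infty=0$). For $1\le r\le\infty$ let $H^{s,r}(\mathbb R)$ be the space of tempered distributions $f$ on $\mathbb R$ with $$\|f\|_{H^{s,r}(\mathbb R)}:=\big\|\mathcal F^{-1}\{(1+k^2)^{s/2}\,\mathcal F\{f\}(k)\}\big\|_{L^r(\mathbb R)}<\infty ,\qquad \mathcal F\{f\}(k)=\int_{\mathbb R}e^{-ikx}f(x)\,dx,$$ and $H^s(\mathbb R):=H^{s,2}(\mathbb R)$. Then there is a constant $C\ge 0$, depending only on $\alpha,\beta,\delta,s,\mu,r$, such that for every $y_0\in H^s(\mathbb R)$ the Cauchy problem $$iy_t+i\beta y_{xxx}+\alpha y_{xx}+i\delta y_x=0,\quad (x,t)\in\mathbb R\times\mathbb R,\qquad y(x,0)=y_0(x),\quad x\in\mathbb R,$$ has a unique solution $y\in C(\mathbb R_t;H^s(\mathbb R))$ (the equation holding in the sense of tempered distributions in $x$ at every time $t$), and for every $T>0$ this solution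 belongs to $L^\mu_t((0,T);H^{s,r}_x(\mathbb R))$ and satisfies $$\|y\|_{L^\mu_t((0,T);H^{s,r}_x(\mathbb R))}\le C\,\|y_0\|_{H^s(\mathbb R)} .$$ -/

import Mathlib

open MeasureTheory
open scoped ENNReal NNReal SchwartzMap

/-- The symbol `(1 + k ^ 2) ^ (s / 2)`. Mathlib's Fourier transform is
`∫ exp (-2 * π * i * x * ξ) * f x`, so the angular frequency is `k = 2 * π * ξ`. -/
noncomputable def besselSymbol (s : ℝ) (ξ : ℝ) : ℂ :=
  (((1 + (2 * Real.pi * ξ) ^ 2) ^ (s / 2) : ℝ) : ℂ)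

/-- The symbol is admissible as a Fourier multiplier (Mathlib gives the multiplier by a function
that is not of temperate growth the junk value `0`). -/
theorem besselSymbol_hasTemperateGrowth (s : ℝ) :
    (besselSymbol s).HasTemperateGrowth := by
  have h : (fun ξ : ℝ => (((1 + ‖(2 * Real.pi) * ξ‖ ^ 2) ^ (s / 2) : ℝ) : ℂ)).HasTemperateGrowth :=
    (show (fun x : ℝ => (((1 + ‖x‖ ^ 2) ^ (s / 2) : ℝ) : ℂ)).HasTemperateGrowth by fun_prop).comp
      (show (fun ξ : ℝ => (2 * Real.pi) * ξ).HasTemperateGrowth by fun_prop)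
  have e : besselSymbol s =
      fun ξ : ℝ => (((1 + ‖(2 * Real.pi) * ξ‖ ^ 2) ^ (s / 2) : ℝ) : ℂ) := by
    ext ξ
    rw [besselSymbol, Real.norm_eq_abs, sq_abs]
  rw [e]
  exact h

/-- The Bessel potential operator `f ↦ 𝓕⁻¹ ((1 + k ^ 2) ^ (s / 2) 𝓕 f)`, that is
`(1 - ∂ₓ ^ 2) ^ (s / 2)`, on tempered distributions on the line. -/
noncomputable def besselOp (s : ℝ) : 𝓢'(ℝ, ℂ) →L[ℂ] 𝓢'(ℝ, ℂ) :=
  TemperedDistribution.fourierMultiplierCLM ℂ (besselSymbol s)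

/-- `f ∈ H^{s,r}(ℝ)`: the tempered distribution `besselOp s f` is (represented by) an `L^r`
function. -/
def MemBessel (s : ℝ) (r : ℝ≥0∞) [Fact (1 ≤ r)] (f : 𝓢'(ℝ, ℂ)) : Prop :=
  ∃ g : Lp ℂ r (volume : Measure ℝ), besselOp s f = (g : 𝓢'(ℝ, ℂ))

/-- The norm of `H^{s,r}(ℝ)`: the `L^r` norm of the (unique) function that represents
`besselOp s f`, and `∞` if there is none. `H^s(ℝ)` is the case `r = 2`. -/
noncomputable def besselENorm (s : ℝ) (r : ℝ≥0∞) [Fact (1 ≤ r)] (f : 𝓢'(ℝ, ℂ)) : ℝ≥0∞ :=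
  ⨅ (g : Lp ℂ r (volume : Measure ℝ)) (_ : besselOp s f = (g : 𝓢'(ℝ, ℂ))), ‖g‖ₑ

/-- `y ∈ C(ℝ; H^s(ℝ))`. -/
def ContinuousInSobolev (s : ℝ) (y : ℝ → 𝓢'(ℝ, ℂ)) : Prop :=
  ∃ F : ℝ → Lp ℂ 2 (volume : Measure ℝ),
    Continuous F ∧ ∀ t, besselOp s (y t) = (F t : 𝓢'(ℝ, ℂ))

/-- `y ∈ L^μ((0,T); H^{s,r}(ℝ))` in the sense of Bochner: for almost every `t ∈ (0,T)` the
distribution `y t` lies in `H^{s,r}(ℝ)`, and `t ↦ besselOp s (y t)` is a strongly measurable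
`L^r`-valued function whose norm is in `L^μ(0,T)`. -/
def MemBochnerBessel (T : ℝ) (μ : ℝ≥0∞) (s : ℝ) (r : ℝ≥0∞) [Fact (1 ≤ r)]
    (y : ℝ → 𝓢'(ℝ, ℂ)) : Prop :=
  ∃ F : ℝ → Lp ℂ r (volume : Measure ℝ),
    MemLp F μ (volume.restrict (Set.Ioo 0 T)) ∧
    ∀ᵐ t ∂(volume.restrict (Set.Ioo 0 T)), besselOp s (y t) = (F t : 𝓢'(ℝ, ℂ))

/-- The norm of `L^μ((0,T); H^{s,r}(ℝ))`: the `L^μ(0,T)` norm of `t ↦ ‖y t‖_{H^{s,r}(ℝ)}`. -/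
noncomputable def bochnerBesselENorm (T : ℝ) (μ : ℝ≥0∞) (s : ℝ) (r : ℝ≥0∞) [Fact (1 ≤ r)]
    (y : ℝ → 𝓢'(ℝ, ℂ)) : ℝ≥0∞ :=
  eLpNorm (fun t => besselENorm s r (y t)) μ (volume.restrict (Set.Ioo 0 T))

/-- The distributional derivative in the space variable. -/
noncomputable def dx (f : 𝓢'(ℝ, ℂ)) : 𝓢'(ℝ, ℂ) :=
  TemperedDistribution.derivCLM ℂ f

/-- `y` is a solution in `C(ℝ; H^s(ℝ))` of the Cauchy problem
`i y_t + i β y_xxx + α y_xx + i δ y_x = 0` on `ℝ × ℝ`, `y(·, 0) = y₀`.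
The equation holds in the sense of tempered distributions at every time `t`;
`y' t` is the time derivative `y_t` at time `t` (with respect to the weak topology of `𝓢'(ℝ)`). -/
structure IsCauchySolution (α β δ s : ℝ) (y₀ : 𝓢'(ℝ, ℂ)) (y : ℝ → 𝓢'(ℝ, ℂ)) : Prop where
  continuousInSobolev : ContinuousInSobolev s y
  equation : ∃ y' : ℝ → 𝓢'(ℝ, ℂ),
    (∀ (t : ℝ) (φ : 𝓢(ℝ, ℂ)), HasDerivAt (fun τ : ℝ => y τ φ) (y' t φ) t) ∧
    ∀ t : ℝ, Complex.I • y' t + (Complex.I * (β : ℂ)) • dx (dx (dx (y t)))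
      + (α : ℂ) • dx (dx (y t)) + (Complex.I * (δ : ℂ)) • dx (y t) = 0
  initial : y 0 = y₀

/-- Higher-order Schrödinger admissible pairs `(μ, r)`; the exponent `∞` is allowed, with
`1 / ∞ = 0`. -/
def IsAdmissiblePair (μ r : ℝ≥0∞) : Prop :=
  2 ≤ μ ∧ 2 ≤ r ∧ 3 / μ + 1 / r = 1 / 2

/-! On the Fourier side the equation reads `∂ₜ ŷ = i P ŷ`, where `P` is a real cubic polynomial with
nonzero leading coefficient. The candidate solution is therefore the Fourier multiplier `exp (i t
P)`, which is unimodular and commutes with `besselOp s`. Every estimate thus reduces to an `L²`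
datum.

Dispersion comes from van der Corput: `∫ exp (i (2 π x ξ + t P(ξ))) dξ` over any interval is `O(|t|
^ (-1/3))`, uniformly in the interval and in `x` (`norm_integral_cexp_cubic_le`). The `TT*` method
and the Hardy–Littlewood–Sobolev inequality turn this into the endpoint estimate `L⁶` in time, `L^∞`
in space. To avoid duality for mixed norms, `TT*` is run for the scalar function `t ↦ u(t, X(t))`
along a measurable curve `X` (`lintegral_waveSum_curve_le`). The bound does not depend on `X`, so
choosing `X(t)` as an almost maximal point of `|u(t, ·)|` recovers the supremum in space.
Interpolating pointwise in time with the `L²` bound gives all admissible pairs, since the condition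
on the exponents says exactly `(1 - 2/r) μ = 6`.

These bounds are proved for data with frequencies in `[-n, n]`, with a constant independent of `n`;
a Cauchy argument in `L^μ(L^r)` removes the cut-off (`exists_strichartz`).

For the Cauchy problem, `H^s` data are tested against Schwartz functions through an `L²` pairing,
and the propagator is moved onto the test function, where it is differentiable in `L²`. This gives
existence. For uniqueness, the pairing of `ŷ(τ)` with `exp (-i τ P) ψ` has zero derivative in `τ`
(`eq_solution_of_hasDerivAt`). -/

open FourierTransform Filter Topology

/-! ### Van der Corput bounds for cubic phases -/

/-- First derivative test for oscillatory integrals whose phase has a derivative of constant sign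
and a second derivative of constant sign. -/
theorem norm_integral_cexp_le_of_le_deriv {ψ ψ₁ ψ₂ : ℝ → ℝ} {a b l : ℝ} (hab : a ≤ b) (hl : 0 < l)
    (h1 : ∀ x, HasDerivAt ψ (ψ₁ x) x) (h2 : ∀ x, HasDerivAt ψ₁ (ψ₂ x) x) (hc : Continuous ψ₂)
    (hpos : ∀ x ∈ Set.Icc a b, 0 ≤ ψ₂ x)
    (hlow : (∀ x ∈ Set.Icc a b, l ≤ ψ₁ x) ∨ (∀ x ∈ Set.Icc a b, ψ₁ x ≤ -l)) :
    ‖∫ x in a..b, Complex.exp (Complex.I * ψ x)‖ ≤ 4 / l := by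
  have hu : Set.uIcc a b = Set.Icc a b := Set.uIcc_of_le hab
  have hne : ∀ x ∈ Set.Icc a b, ψ₁ x ≠ 0 := by
    rcases hlow with h | h <;> intro x hx h0 <;> have := h x hx <;> linarith
  have habs : ∀ x ∈ Set.Icc a b, |(ψ₁ x)⁻¹| ≤ 1 / l := by
    intro x hx
    rw [abs_inv, ← one_div]
    apply one_div_le_one_div_of_le hl
    rcases hlow with h | h
    · exact (h x hx).trans (le_abs_self _)
    · exact (le_neg.mp (h x hx)).trans (neg_le_abs _)
  have c1 : Continuous ψ₁ := continuous_iff_continuousAt.2 fun x => (h2 x).continuousAt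
  have c0 : Continuous ψ := continuous_iff_continuousAt.2 fun x => (h1 x).continuousAt
  have hinv : ∀ x ∈ Set.uIcc a b, HasDerivAt (fun x => (ψ₁ x)⁻¹) (-ψ₂ x / ψ₁ x ^ 2) x :=
    fun x hx => (h2 x).inv (hne x (hu ▸ hx))
  have hcinv : ContinuousOn (fun x => -ψ₂ x / ψ₁ x ^ 2) (Set.uIcc a b) := by
    apply ContinuousOn.div (by fun_prop) (by fun_prop)
    intro x hx
    exact pow_ne_zero _ (hne x (hu ▸ hx))
  have hexp : ∀ x, HasDerivAt (fun x => Complex.exp (Complex.I * ψ x))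
      (Complex.exp (Complex.I * ψ x) * (Complex.I * ψ₁ x)) x := fun x =>
    (((h1 x).ofReal_comp).const_mul Complex.I).cexp
  -- Integrate by parts in `exp (i ψ) = (i ψ₁)⁻¹ (exp (i ψ))'`; the two boundary terms cost `1 / l`
  -- each.
  have hparts := intervalIntegral.integral_mul_deriv_eq_deriv_mul
    (u := fun x => (((ψ₁ x)⁻¹ : ℝ) : ℂ)) (u' := fun x => ((-ψ₂ x / ψ₁ x ^ 2 : ℝ) : ℂ))
    (v := fun x => Complex.exp (Complex.I * ψ x))
    (v' := fun x => Complex.exp (Complex.I * ψ x) * (Complex.I * ψ₁ x)) (a := a) (b := b)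
    (fun x hx => (hinv x hx).ofReal_comp) (fun x _ => hexp x)
    ((Complex.continuous_ofReal.comp_continuousOn hcinv).intervalIntegrable)
    ((by fun_prop : Continuous fun x =>
      Complex.exp (Complex.I * ψ x) * (Complex.I * ψ₁ x)).intervalIntegrable _ _)
  have hlhs : ∫ x in a..b, (((ψ₁ x)⁻¹ : ℝ) : ℂ) *
      (Complex.exp (Complex.I * ψ x) * (Complex.I * ψ₁ x)) =
      Complex.I * ∫ x in a..b, Complex.exp (Complex.I * ψ x) := by
    rw [← intervalIntegral.integral_const_mul]
    apply intervalIntegral.integral_congr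
    intro x hx
    have : (ψ₁ x : ℂ) ≠ 0 := by exact_mod_cast hne x (hu ▸ hx)
    simp only [Complex.ofReal_inv]
    field_simp
  have hE : ∀ x, ‖Complex.exp (Complex.I * ψ x)‖ = 1 := fun x => by
    rw [mul_comm]; exact Complex.norm_exp_ofReal_mul_I _
  -- Since `ψ₂ ≥ 0`, the derivative of `1 / ψ₁` has constant sign, so its absolute value integrates
  -- to a difference of boundary values.
  have hrem : ‖∫ x in a..b, ((-ψ₂ x / ψ₁ x ^ 2 : ℝ) : ℂ) * Complex.exp (Complex.I * ψ x)‖ ≤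
      2 / l := by
    calc _ ≤ ∫ x in a..b, ‖((-ψ₂ x / ψ₁ x ^ 2 : ℝ) : ℂ) * Complex.exp (Complex.I * ψ x)‖ :=
          intervalIntegral.norm_integral_le_integral_norm hab
      _ = ∫ x in a..b, -(-ψ₂ x / ψ₁ x ^ 2) := by
          apply intervalIntegral.integral_congr
          intro x hx
          simp only
          rw [norm_mul, hE, mul_one, Complex.norm_real, Real.norm_eq_abs, abs_of_nonpos]
          have := hpos x (hu ▸ hx)
          apply div_nonpos_of_nonpos_of_nonneg (by linarith) (by positivity)
      _ = -((ψ₁ b)⁻¹ - (ψ₁ a)⁻¹) := by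
          rw [intervalIntegral.integral_neg,
            intervalIntegral.integral_eq_sub_of_hasDerivAt hinv hcinv.intervalIntegrable]
      _ ≤ 2 / l := by
          have h1 := abs_le.1 (habs a (Set.left_mem_Icc.2 hab))
          have h2 := abs_le.1 (habs b (Set.right_mem_Icc.2 hab))
          have : 2 / l = 1 / l + 1 / l := by ring
          linarith
  have hI : ‖∫ x in a..b, Complex.exp (Complex.I * ψ x)‖ =
      ‖Complex.I * ∫ x in a..b, Complex.exp (Complex.I * ψ x)‖ := by
    rw [norm_mul, Complex.norm_I, one_mul]
  rw [hI, ← hlhs, hparts]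
  have hb : ∀ x ∈ Set.Icc a b, ‖(((ψ₁ x)⁻¹ : ℝ) : ℂ) * Complex.exp (Complex.I * ψ x)‖ ≤ 1 / l := by
    intro x hx
    rw [norm_mul, hE, mul_one, Complex.norm_real, Real.norm_eq_abs]
    exact habs x hx
  have e : 4 / l = 1 / l + 1 / l + 2 / l := by ring
  rw [e]
  refine (norm_sub_le _ _).trans (add_le_add ((norm_sub_le _ _).trans
    (add_le_add (hb b (Set.right_mem_Icc.2 hab)) (hb a (Set.left_mem_Icc.2 hab)))) hrem)

theorem norm_integral_cexp_le_length (ψ : ℝ → ℝ) {a b : ℝ} (hab : a ≤ b) :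
    ‖∫ x in a..b, Complex.exp (Complex.I * ψ x)‖ ≤ b - a := by
  have := intervalIntegral.norm_integral_le_of_norm_le_const (a := a) (b := b) (C := 1)
    (f := fun x => Complex.exp (Complex.I * ψ x)) (fun x _ => by
      rw [mul_comm]; exact (Complex.norm_exp_ofReal_mul_I _).le)
  rwa [one_mul, abs_of_nonneg (by linarith)] at this

/-- The depressed cubic phase on a half line. -/
theorem norm_integral_cexp_depressed_cubic_le {A c d a b : ℝ} (hd : 0 < d) (hA : A * d ^ 3 = 1)
    (ha : 0 ≤ a) (hab : a ≤ b) :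
    ‖∫ x in a..b, Complex.exp (Complex.I * (A * (x ^ 3 / 3 + c * x) : ℝ))‖ ≤ 10 * d := by
  have hApos : 0 < A := by
    by_contra h
    have : A * d ^ 3 ≤ 0 := mul_nonpos_of_nonpos_of_nonneg (not_lt.1 h) (by positivity)
    linarith
  set ψ : ℝ → ℝ := fun x => A * (x ^ 3 / 3 + c * x) with hψ
  have h1 : ∀ x, HasDerivAt ψ (A * (x ^ 2 + c)) x := by
    intro x
    have := ((((hasDerivAt_id x).pow 3).div_const 3).add ((hasDerivAt_id x).const_mul c)).const_mul A
    refine this.congr_deriv ?_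
    simp
  have h2 : ∀ x, HasDerivAt (fun x : ℝ => A * (x ^ 2 + c)) (A * (2 * x)) x := by
    intro x
    have := (((hasDerivAt_id x).pow 2).add_const c).const_mul A
    refine this.congr_deriv ?_
    simp
  have hcont : Continuous ψ := by fun_prop
  have hint : ∀ a b, IntervalIntegrable (fun x => Complex.exp (Complex.I * ψ x)) volume a b :=
    fun a b => (by fun_prop : Continuous fun x =>
      Complex.exp (Complex.I * ψ x)).intervalIntegrable _ _
  -- For `x ≥ 0`, the inequality `|x ^ 2 + c| < d ^ 2` forces `p ≤ x ≤ q`. Outside `[p, q]` the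
  -- phase has `|ψ'| ≥ A d ^ 2 = 1 / d`, and each side contributes `4 d`; the middle has length at
  -- most `2 d`. Square roots of negative numbers are `0`, which makes the missing pieces empty.
  set p := √(-c - d ^ 2)
  set q := √(-c + d ^ 2)
  have hpq : p ≤ q := Real.sqrt_le_sqrt (by nlinarith)
  have hp0 : 0 ≤ p := Real.sqrt_nonneg _
  have hq0 : 0 ≤ q := Real.sqrt_nonneg _
  have hqp : q - p ≤ 2 * d := by
    have hq2 : q ^ 2 ≤ p ^ 2 + 2 * d ^ 2 := by
      rcases le_total 0 (-c - d ^ 2) with h | h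
      · have e1 : p ^ 2 = -c - d ^ 2 := Real.sq_sqrt h
        have e2 : q ^ 2 = -c + d ^ 2 := Real.sq_sqrt (by nlinarith)
        linarith
      · rcases le_total 0 (-c + d ^ 2) with h' | h'
        · have e2 : q ^ 2 = -c + d ^ 2 := Real.sq_sqrt h'
          nlinarith
        · have : q = 0 := Real.sqrt_eq_zero_of_nonpos h'
          rw [this]; nlinarith [sq_nonneg p, sq_nonneg d]
    nlinarith
  -- Clamp the two break points to `[a, b]`.
  set p' := max a (min b p)
  set q' := max a (min b q)
  have hap : a ≤ p' := le_max_left _ _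
  have hqb : q' ≤ b := max_le hab (min_le_left _ _)
  have hpq' : p' ≤ q' := max_le_max le_rfl (min_le_min le_rfl hpq)
  have hlen : q' - p' ≤ 2 * d := by
    have : q' ≤ p' + (q - p) := by
      apply max_le
      · linarith
      · rcases le_total b p with h | h
        · have : b ≤ p' := by simp [p', h]
          have := min_le_left b q
          linarith
        · have : p ≤ p' := by simp [p', h]
          have := min_le_right b q
          linarith
    linarith
  have e4 : 4 / (A * d ^ 2) = 4 * d := by
    field_simp
    linarith [hA]
  have I1 : ‖∫ x in a..p', Complex.exp (Complex.I * ψ x)‖ ≤ 4 * d := by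
    rcases le_or_gt p a with h | h
    · have : p' = a := max_eq_left ((min_le_right _ _).trans h)
      rw [this]; simp; positivity
    · rw [← e4]
      refine norm_integral_cexp_le_of_le_deriv hap (by positivity) h1 h2 (by fun_prop) ?_ ?_
      · intro x hx; have : 0 ≤ x := ha.trans hx.1; positivity
      · right
        intro x hx
        have hp'p : p' ≤ p := max_le h.le (min_le_right _ _)
        have hxp : x ≤ p := hx.2.trans hp'p
        have e1 : p ^ 2 = -c - d ^ 2 := Real.sq_sqrt (Real.sqrt_pos.1 (ha.trans_lt h)).le
        have : x ^ 2 ≤ p ^ 2 := pow_le_pow_left₀ (ha.trans hx.1) hxp 2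
        nlinarith
  have I3 : ‖∫ x in q'..b, Complex.exp (Complex.I * ψ x)‖ ≤ 4 * d := by
    rcases le_total b q with h | h
    · have : q' = b := by simp [q', h, hab]
      rw [this]; simp; positivity
    · rw [← e4]
      refine norm_integral_cexp_le_of_le_deriv hqb (by positivity) h1 h2 (by fun_prop) ?_ ?_
      · intro x hx; have : 0 ≤ x := (ha.trans (le_max_left _ _)).trans hx.1; positivity
      · left
        intro x hx
        have hq'q : q ≤ q' := by simp [q', h]
        have hxq : q ≤ x := hq'q.trans hx.1
        have : -c + d ^ 2 ≤ x ^ 2 := by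
          rw [← Real.sqrt_le_left (hq0.trans hxq)]; exact hxq
        nlinarith
  have I2 := norm_integral_cexp_le_length ψ hpq'
  have hsplit : ∫ x in a..b, Complex.exp (Complex.I * ψ x) =
      (∫ x in a..p', Complex.exp (Complex.I * ψ x)) + (∫ x in p'..q', Complex.exp (Complex.I * ψ x))
      + ∫ x in q'..b, Complex.exp (Complex.I * ψ x) := by
    rw [intervalIntegral.integral_add_adjacent_intervals (hint _ _) (hint _ _),
      intervalIntegral.integral_add_adjacent_intervals (hint _ _) (hint _ _)]
  change ‖∫ x in a..b, Complex.exp (Complex.I * ψ x)‖ ≤ _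
  rw [hsplit]
  have := norm_add₃_le (a := ∫ x in a..p', Complex.exp (Complex.I * ψ x))
    (b := ∫ x in p'..q', Complex.exp (Complex.I * ψ x))
    (c := ∫ x in q'..b, Complex.exp (Complex.I * ψ x))
  linarith

/-- Complex conjugation reverses the sign of the phase. This allows a positive leading coefficient
to be assumed and, for an odd phase, carries bounds from one half line to the other. -/
theorem norm_integral_cexp_neg (ψ : ℝ → ℝ) (a b : ℝ) :
    ‖∫ x in a..b, Complex.exp (Complex.I * (-ψ x : ℝ))‖ =
      ‖∫ x in a..b, Complex.exp (Complex.I * ψ x)‖ := by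
  have : ∀ x, Complex.exp (Complex.I * (-ψ x : ℝ)) =
      (starRingEnd ℂ) (Complex.exp (Complex.I * ψ x)) := by
    intro x
    rw [← Complex.exp_conj]
    simp
  simp_rw [this]
  rw [intervalIntegral.intervalIntegral_eq_integral_uIoc,
    intervalIntegral.intervalIntegral_eq_integral_uIoc, norm_smul, norm_smul, integral_conj,
    RCLike.norm_conj]

/-- Van der Corput's bound for a cubic phase, uniform in the interval and in the lower order
coefficients. -/
theorem norm_integral_cexp_cubic_le {A : ℝ} (hA : A ≠ 0) (c₂ c₁ a b : ℝ) :
    ‖∫ x in a..b, Complex.exp (Complex.I * (A * x ^ 3 + c₂ * x ^ 2 + c₁ * x : ℝ))‖ ≤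
      20 * |A| ^ (-(1 / 3) : ℝ) := by
  wlog hpos : 0 < A generalizing A c₂ c₁
  · have := this (A := -A) (neg_ne_zero.2 hA) (-c₂) (-c₁)
      (by have := lt_of_le_of_ne (not_lt.1 hpos) hA; linarith)
    rw [abs_neg, ← norm_integral_cexp_neg] at this
    convert this using 6
    push_cast
    ring
  wlog hab : a ≤ b generalizing a b
  · rw [intervalIntegral.integral_symm, norm_neg]
    exact this b a (le_of_not_ge hab)
  -- Translation by `h` removes the quadratic term at the price of a unimodular constant. The scale
  -- `d` solves `3 A d ^ 3 = 1`, and the depressed phase is odd, so two half lines give `2 * 10 d`.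
  set h := c₂ / (3 * A)
  set c := c₁ / (3 * A) - h ^ 2
  set d := (3 * A) ^ (-(1 / 3) : ℝ)
  have hd : 0 < d := by positivity
  have hd3 : 3 * A * d ^ 3 = 1 := by
    rw [← Real.rpow_natCast, ← Real.rpow_mul (by positivity)]
    norm_num
    rw [Real.rpow_neg_one]
    field_simp
  have hdA : d ≤ |A| ^ (-(1 / 3) : ℝ) := by
    rw [abs_of_pos hpos]
    exact Real.rpow_le_rpow_of_nonpos hpos (by linarith) (by norm_num)
  set ψ : ℝ → ℝ := fun x => 3 * A * (x ^ 3 / 3 + c * x) with hψ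
  have hint : ∀ a b, IntervalIntegrable (fun x => Complex.exp (Complex.I * ψ x)) volume a b :=
    fun a b => (by fun_prop : Continuous fun x =>
      Complex.exp (Complex.I * ψ x)).intervalIntegrable _ _
  have key : ∀ a b, 0 ≤ a → a ≤ b →
      ‖∫ x in a..b, Complex.exp (Complex.I * ψ x)‖ ≤ 10 * d := fun a b ha hab =>
    norm_integral_cexp_depressed_cubic_le hd hd3 ha hab
  have key' : ∀ a b, b ≤ 0 → a ≤ b →
      ‖∫ x in a..b, Complex.exp (Complex.I * ψ x)‖ ≤ 10 * d := by
    intro a b hb hab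
    have := key (-b) (-a) (by linarith) (by linarith)
    rw [← norm_integral_cexp_neg] at this
    have e : ∀ x, -ψ x = ψ (-x) := fun x => by simp only [hψ]; ring
    simp_rw [e] at this
    rw [intervalIntegral.integral_comp_neg (fun x => Complex.exp (Complex.I * ψ x))] at this
    simpa using this
  have all : ∀ a b, a ≤ b → ‖∫ x in a..b, Complex.exp (Complex.I * ψ x)‖ ≤ 20 * d := by
    intro a b hab
    rcases le_total 0 a with ha | ha
    · linarith [key a b ha hab]
    rcases le_total b 0 with hb | hb
    · linarith [key' a b hb hab]
    rw [← intervalIntegral.integral_add_adjacent_intervals (hint a 0) (hint 0 b)]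
    have := norm_add_le (∫ x in a..0, Complex.exp (Complex.I * ψ x))
      (∫ x in (0:ℝ)..b, Complex.exp (Complex.I * ψ x))
    linarith [key 0 b le_rfl hb, key' a 0 le_rfl ha]
  have hshift : ∀ x : ℝ, Complex.exp (Complex.I * (A * x ^ 3 + c₂ * x ^ 2 + c₁ * x : ℝ)) =
      Complex.exp (Complex.I * (-(A * h ^ 3 + 3 * A * c * h) : ℝ)) *
        Complex.exp (Complex.I * ψ (x + h)) := by
    intro x
    rw [← Complex.exp_add, ← mul_add, ← Complex.ofReal_add]
    congr 3
    have e2 : c₂ = 3 * A * h := by simp only [h]; field_simp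
    have e1 : c₁ = 3 * A * (c + h ^ 2) := by simp only [c]; field_simp; ring
    simp only [hψ]
    rw [e1, e2]
    ring
  simp_rw [hshift]
  rw [intervalIntegral.integral_const_mul, norm_mul, mul_comm Complex.I,
    Complex.norm_exp_ofReal_mul_I, one_mul,
    intervalIntegral.integral_comp_add_right (fun x => Complex.exp (Complex.I * ψ x))]
  exact (all _ _ (by linarith)).trans (by linarith)

/-! ### The Hardy–Littlewood–Sobolev inequality -/

theorem lintegral_comp_abs_sub {F : ℝ → ℝ≥0∞} (s : ℝ) :
    ∫⁻ t, F |t - s| = 2 * ∫⁻ t in Set.Ioi 0, F t := by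
  rw [lintegral_sub_right_eq_self (fun t => F |t|) s,
    ← lintegral_add_compl _ (measurableSet_Ioi (a := (0 : ℝ))), Set.compl_Ioi, two_mul]
  have h1 : ∫⁻ t in Set.Ioi 0, F |t| = ∫⁻ t in Set.Ioi 0, F t :=
    setLIntegral_congr_fun measurableSet_Ioi fun t ht => by
      simp only [abs_of_pos (Set.mem_Ioi.1 ht)]
  have h2 : ∫⁻ t in Set.Iic 0, F |t| = ∫⁻ t in Set.Ioi 0, F t := by
    have hmp := (Measure.measurePreserving_neg (volume : Measure ℝ)).setLIntegral_comp_preimage_emb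
      (MeasurableEquiv.neg ℝ).measurableEmbedding F (Set.Ici 0)
    rw [Set.neg_preimage, Set.neg_Ici, neg_zero, setLIntegral_congr Ioi_ae_eq_Ici.symm] at hmp
    rw [← hmp]
    exact setLIntegral_congr_fun measurableSet_Iic fun t ht => by
      simp only [abs_of_nonpos (Set.mem_Iic.1 ht)]
  rw [h1, h2]

theorem lintegral_abs_sub_rpow_near (s : ℝ) {R : ℝ} (hR : 0 < R) :
    ∫⁻ t in Set.Ioo (s - R) (s + R), ENNReal.ofReal (|t - s| ^ (-(1 / 3) : ℝ)) ≤
      ENNReal.ofReal (3 * R ^ (2 / 3 : ℝ)) := by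
  set F : ℝ → ℝ≥0∞ := (Set.Iio R).indicator fun t => ENNReal.ofReal (t ^ (-(1 / 3) : ℝ))
  have h1 : ∫⁻ t in Set.Ioo (s - R) (s + R), ENNReal.ofReal (|t - s| ^ (-(1 / 3) : ℝ)) =
      ∫⁻ t, F |t - s| := by
    rw [← lintegral_indicator measurableSet_Ioo]
    apply lintegral_congr
    intro t
    have : t ∈ Set.Ioo (s - R) (s + R) ↔ |t - s| ∈ Set.Iio R := by
      rw [Set.mem_Iio, abs_sub_lt_iff, Set.mem_Ioo]
      constructor <;> intro h <;> constructor <;> linarith [h.1, h.2]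
    simp only [F]
    by_cases h : |t - s| ∈ Set.Iio R
    · rw [Set.indicator_of_mem (this.2 h), Set.indicator_of_mem h]
    · rw [Set.indicator_of_notMem (fun h' => h (this.1 h')), Set.indicator_of_notMem h]
  have hint : IntervalIntegrable (fun t : ℝ => t ^ (-(1 / 3) : ℝ)) volume 0 R :=
    intervalIntegral.intervalIntegrable_rpow' (by norm_num)
  rw [h1, lintegral_comp_abs_sub, setLIntegral_indicator measurableSet_Iio, Set.inter_comm,
    Set.Ioi_inter_Iio, ← setLIntegral_congr Ioo_ae_eq_Ioc.symm,
    ← ofReal_integral_eq_lintegral_ofReal ((intervalIntegrable_iff_integrableOn_Ioc_of_le hR.le).1 hint)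
      ((ae_restrict_iff' measurableSet_Ioc).2 (ae_of_all _ fun t ht => by
        have := ht.1; simp only [Pi.zero_apply]; positivity)),
    ← intervalIntegral.integral_of_le hR.le, integral_rpow (Or.inl (by norm_num)),
    ← ENNReal.ofReal_ofNat, ← ENNReal.ofReal_mul (by norm_num)]
  apply ENNReal.ofReal_le_ofReal
  rw [Real.zero_rpow (by norm_num)]
  norm_num
  apply le_of_eq
  ring

theorem lintegral_abs_sub_rpow_far (s : ℝ) {R : ℝ} (hR : 0 < R) :
    ∫⁻ t in (Set.Ioo (s - R) (s + R))ᶜ, ENNReal.ofReal (|t - s| ^ (-(1 / 3) : ℝ)) ^ (6 : ℝ) ≤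
      ENNReal.ofReal (2 / R) := by
  set F : ℝ → ℝ≥0∞ := (Set.Ici R).indicator fun t => ENNReal.ofReal (t ^ (-2 : ℝ))
  have h1 : ∫⁻ t in (Set.Ioo (s - R) (s + R))ᶜ,
      ENNReal.ofReal (|t - s| ^ (-(1 / 3) : ℝ)) ^ (6 : ℝ) = ∫⁻ t, F |t - s| := by
    rw [← lintegral_indicator measurableSet_Ioo.compl]
    apply lintegral_congr
    intro t
    have : t ∈ (Set.Ioo (s - R) (s + R))ᶜ ↔ |t - s| ∈ Set.Ici R := by
      rw [← not_iff_not, Set.notMem_compl_iff, Set.mem_Ici, not_le, abs_sub_lt_iff, Set.mem_Ioo]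
      constructor <;> intro h <;> constructor <;> linarith [h.1, h.2]
    simp only [F]
    by_cases h : |t - s| ∈ Set.Ici R
    · rw [Set.indicator_of_mem (this.2 h), Set.indicator_of_mem h,
        ENNReal.ofReal_rpow_of_nonneg (by positivity) (by norm_num), ← Real.rpow_mul (abs_nonneg _)]
      norm_num
    · rw [Set.indicator_of_notMem (fun h' => h (this.1 h')), Set.indicator_of_notMem h]
  have hset : Set.Ici R ∩ Set.Ioi 0 = Set.Ici R :=
    Set.inter_eq_left.2 fun t ht => hR.trans_le ht
  rw [h1, lintegral_comp_abs_sub, setLIntegral_indicator measurableSet_Ici, hset,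
    ← setLIntegral_congr Ioi_ae_eq_Ici,
    ← ofReal_integral_eq_lintegral_ofReal (integrableOn_Ioi_rpow_of_lt (by norm_num) hR)
      ((ae_restrict_iff' measurableSet_Ioi).2 (ae_of_all _ fun t ht => by
        have : 0 < t := hR.trans ht
        simp only [Pi.zero_apply]; positivity)),
    integral_Ioi_rpow_of_lt (by norm_num) hR,
    ← ENNReal.ofReal_ofNat, ← ENNReal.ofReal_mul (by norm_num)]
  apply ENNReal.ofReal_le_ofReal
  norm_num
  rw [Real.rpow_neg_one]
  apply le_of_eq
  ring

/-- Split at distance `R` from `s`. Nearby, `G ≤ m` and the kernel is integrable; far away, Hölder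
with exponents `6/5` and `6` applies because the sixth power of the kernel is `|t - s| ^ (-2)`. -/
theorem lintegral_level_mul_abs_sub_rpow_le {G : ℝ → ℝ≥0∞} (hG : Measurable G) {m n : ℝ}
    (hm : 0 < m) (hn : 0 < n) (hN : ∫⁻ t, G t ^ (6 / 5 : ℝ) = ENNReal.ofReal n) (s : ℝ) :
    ∫⁻ t in {t | G t ≤ ENNReal.ofReal m}, G t * ENNReal.ofReal (|t - s| ^ (-(1 / 3) : ℝ)) ≤
      ENNReal.ofReal (5 * m ^ (1 / 5 : ℝ) * n ^ (2 / 3 : ℝ)) := by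
  -- This `R` balances `m R ^ (2/3)` (near) against `n ^ (5/6) R ^ (-1/6)` (far); both become `m ^
  -- (1/5) n ^ (2/3)`.
  set R := n * m ^ (-(6 / 5) : ℝ) with hRdef
  have hR : 0 < R := by positivity
  set S := Set.Ioo (s - R) (s + R)
  set K : ℝ → ℝ≥0∞ := fun t => ENNReal.ofReal (|t - s| ^ (-(1 / 3) : ℝ))
  have hK : Measurable K := by fun_prop
  set E := {t | G t ≤ ENNReal.ofReal m}
  have hE : MeasurableSet E := measurableSet_le hG measurable_const
  have hS : MeasurableSet S := measurableSet_Ioo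
  have near : ∫⁻ t in E ∩ S, G t * K t ≤ ENNReal.ofReal (3 * m ^ (1 / 5 : ℝ) * n ^ (2 / 3 : ℝ)) :=
    calc ∫⁻ t in E ∩ S, G t * K t ≤ ∫⁻ t in E ∩ S, ENNReal.ofReal m * K t :=
          setLIntegral_mono (by fun_prop) fun t ht => mul_le_mul_left ht.1 _
      _ ≤ ∫⁻ t in S, ENNReal.ofReal m * K t := lintegral_mono_set Set.inter_subset_right
      _ = ENNReal.ofReal m * ∫⁻ t in S, K t := lintegral_const_mul _ hK
      _ ≤ ENNReal.ofReal m * ENNReal.ofReal (3 * R ^ (2 / 3 : ℝ)) := by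
          gcongr; exact lintegral_abs_sub_rpow_near s hR
      _ = ENNReal.ofReal (3 * m ^ (1 / 5 : ℝ) * n ^ (2 / 3 : ℝ)) := by
          rw [← ENNReal.ofReal_mul hm.le]
          congr 1
          rw [hRdef, Real.mul_rpow hn.le (by positivity), ← Real.rpow_mul hm.le]
          have : m ^ (1 / 5 : ℝ) = m * m ^ (-(6 / 5) * (2 / 3) : ℝ) := by
            rw [← Real.rpow_one_add' hm.le (by norm_num)]; norm_num
          rw [this]; ring
  have far : ∫⁻ t in Sᶜ, G t * K t ≤ ENNReal.ofReal (2 * m ^ (1 / 5 : ℝ) * n ^ (2 / 3 : ℝ)) :=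
    calc ∫⁻ t in Sᶜ, G t * K t ≤ (∫⁻ t in Sᶜ, G t ^ (6 / 5 : ℝ)) ^ (1 / (6 / 5) : ℝ) *
          (∫⁻ t in Sᶜ, K t ^ (6 : ℝ)) ^ (1 / 6 : ℝ) :=
          ENNReal.lintegral_mul_le_Lp_mul_Lq _ (by
            rw [Real.holderConjugate_iff]; norm_num) hG.aemeasurable hK.aemeasurable
      _ ≤ ENNReal.ofReal n ^ (1 / (6 / 5) : ℝ) * ENNReal.ofReal (2 / R) ^ (1 / 6 : ℝ) := by
          gcongr
          · rw [← hN]; exact setLIntegral_le_lintegral _ _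
          · exact lintegral_abs_sub_rpow_far s hR
      _ ≤ ENNReal.ofReal (2 * m ^ (1 / 5 : ℝ) * n ^ (2 / 3 : ℝ)) := by
          rw [ENNReal.ofReal_rpow_of_pos hn, ENNReal.ofReal_rpow_of_pos (by positivity),
            ← ENNReal.ofReal_mul (by positivity)]
          apply ENNReal.ofReal_le_ofReal
          rw [Real.div_rpow (by norm_num) hR.le, hRdef, Real.mul_rpow hn.le (by positivity),
            ← Real.rpow_mul hm.le]
          have h2 : (2 : ℝ) ^ (1 / 6 : ℝ) ≤ 2 := by
            conv_rhs => rw [← Real.rpow_one 2]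
            exact Real.rpow_le_rpow_of_exponent_le (by norm_num) (by norm_num)
          have e1 : n ^ (1 / (6 / 5) : ℝ) = n ^ (2 / 3 : ℝ) * n ^ (1 / 6 : ℝ) := by
            rw [← Real.rpow_add hn]; norm_num
          have e2 : m ^ (1 / 5 : ℝ) * m ^ (-(6 / 5) * (1 / 6) : ℝ) = 1 := by
            rw [← Real.rpow_add hm]; norm_num
          have e3 : n ^ (1 / (6 / 5) : ℝ) *
              (2 ^ (1 / 6 : ℝ) / (n ^ (1 / 6 : ℝ) * m ^ (-(6 / 5) * (1 / 6) : ℝ))) =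
              2 ^ (1 / 6 : ℝ) * m ^ (1 / 5 : ℝ) * n ^ (2 / 3 : ℝ) := by
            rw [e1]
            have h3 : n ^ (1 / 6 : ℝ) ≠ 0 := by positivity
            have h4 : m ^ (-(6 / 5) * (1 / 6) : ℝ) ≠ 0 := by positivity
            generalize n ^ (1 / 6 : ℝ) = u at *
            generalize n ^ (2 / 3 : ℝ) = v at *
            generalize m ^ (-(6 / 5) * (1 / 6) : ℝ) = w at *
            generalize m ^ (1 / 5 : ℝ) = z at *
            generalize (2 : ℝ) ^ (1 / 6 : ℝ) = y at *
            rw [← mul_div_assoc, div_eq_iff (mul_ne_zero h3 h4)]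
            linear_combination (-(y * v * u)) * e2
          rw [e3]
          gcongr
  calc ∫⁻ t in E, G t * K t ≤ ∫⁻ t in (E ∩ S) ∪ Sᶜ, G t * K t :=
        lintegral_mono_set fun t ht => by
          by_cases h : t ∈ S
          · exact Or.inl ⟨ht, h⟩
          · exact Or.inr h
    _ ≤ (∫⁻ t in E ∩ S, G t * K t) + ∫⁻ t in Sᶜ, G t * K t := lintegral_union_le _ _ _
    _ ≤ _ := add_le_add near far
    _ = _ := by
        rw [← ENNReal.ofReal_add (by positivity) (by positivity)]
        congr 1; ring

/-- The Hardy–Littlewood–Sobolev inequality on the line for the kernel `|t - s| ^ (-1/3)`. -/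
theorem lintegral_lintegral_mul_abs_sub_rpow_le {G : ℝ → ℝ≥0∞} (hG : Measurable G)
    (hfin : ∀ t, G t ≠ ∞) :
    ∫⁻ s, ∫⁻ t, G s * (G t * ENNReal.ofReal (|t - s| ^ (-(1 / 3) : ℝ))) ≤
      10 * (∫⁻ t, G t ^ (6 / 5 : ℝ)) ^ (5 / 3 : ℝ) := by
  set N := ∫⁻ t, G t ^ (6 / 5 : ℝ)
  rcases eq_or_ne N ∞ with htop | htop
  · rw [htop]; simp
  rcases eq_or_ne N 0 with h0 | h0
  · have hz := (lintegral_eq_zero_iff (by fun_prop)).1 h0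
    have hz' : ∀ᵐ t, G t = 0 := by
      filter_upwards [hz] with t ht
      rcases ENNReal.rpow_eq_zero_iff.1 ht with h | h
      · exact h.1
      · exact absurd h.1 (hfin t)
    have : ∫⁻ s, ∫⁻ t, G s * (G t * ENNReal.ofReal (|t - s| ^ (-(1 / 3) : ℝ))) = ∫⁻ s : ℝ, 0 := by
      apply lintegral_congr_ae
      filter_upwards [hz'] with s hs
      simp [hs]
    rw [this]; simp
  set n := N.toReal
  have hn : 0 < n := ENNReal.toReal_pos h0 htop
  have hnN : ENNReal.ofReal n = N := ENNReal.ofReal_toReal htop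
  set K : ℝ → ℝ → ℝ≥0∞ := fun s t => ENNReal.ofReal (|t - s| ^ (-(1 / 3) : ℝ))
  have hKm : Measurable (Function.uncurry K) := by
    simp only [K, Function.uncurry_def]; fun_prop
  have hsymm : ∀ s t, K s t = K t s := fun s t => by simp only [K]; rw [abs_sub_comm]
  -- The kernel is symmetric, so it suffices, up to a factor `2`, to integrate over `G t ≤ G s`.
  -- There the level bound with `m = G s` applies, and `G s * (G s) ^ (1/5)` is the power `6/5` that
  -- the outer integral needs.
  set Φ : ℝ → ℝ → ℝ≥0∞ := fun s t => if G t ≤ G s then G s * (G t * K s t) else 0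
  have hΦ : Measurable (Function.uncurry Φ) := by
    apply Measurable.ite
    · exact measurableSet_le (hG.comp measurable_snd) (hG.comp measurable_fst)
    · exact (hG.comp measurable_fst).mul ((hG.comp measurable_snd).mul hKm)
    · exact measurable_const
  have hle : ∀ s t, G s * (G t * K s t) ≤ Φ s t + Φ t s := by
    intro s t
    rcases le_total (G t) (G s) with h | h
    · simp [Φ, h]
    · rw [mul_left_comm]
      simp [Φ, h, hsymm s t]
  have hinner : ∀ s, ∫⁻ t, Φ s t ≤ ENNReal.ofReal 5 * N ^ (2 / 3 : ℝ) * G s ^ (6 / 5 : ℝ) := by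
    intro s
    rcases eq_or_ne (G s) 0 with hs | hs
    · simp [Φ, hs]
    set m := (G s).toReal
    have hm : 0 < m := ENNReal.toReal_pos hs (hfin s)
    have hmG : ENNReal.ofReal m = G s := ENNReal.ofReal_toReal (hfin s)
    have hset : MeasurableSet {t | G t ≤ ENNReal.ofReal m} := measurableSet_le hG measurable_const
    calc ∫⁻ t, Φ s t = G s * ∫⁻ t in {t | G t ≤ ENNReal.ofReal m}, G t * K s t := by
          rw [← lintegral_const_mul _ (by fun_prop), ← lintegral_indicator hset]
          apply lintegral_congr
          intro t
          simp [Φ, Set.indicator_apply, hmG]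
      _ ≤ G s * ENNReal.ofReal (5 * m ^ (1 / 5 : ℝ) * n ^ (2 / 3 : ℝ)) := by
          gcongr
          exact lintegral_level_mul_abs_sub_rpow_le hG hm hn hnN.symm s
      _ = _ := by
          rw [← hmG, ← hnN, ENNReal.ofReal_rpow_of_pos hm, ENNReal.ofReal_rpow_of_pos hn,
            ← ENNReal.ofReal_mul hm.le, ← ENNReal.ofReal_mul (by norm_num),
            ← ENNReal.ofReal_mul (by positivity)]
          congr 1
          have : m ^ (6 / 5 : ℝ) = m * m ^ (1 / 5 : ℝ) := by
            rw [← Real.rpow_one_add' hm.le (by norm_num)]; norm_num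
          rw [this]; ring
  have houter : ∫⁻ s, ∫⁻ t, Φ s t ≤ ENNReal.ofReal 5 * N ^ (5 / 3 : ℝ) :=
    calc ∫⁻ s, ∫⁻ t, Φ s t ≤ ∫⁻ s, ENNReal.ofReal 5 * N ^ (2 / 3 : ℝ) * G s ^ (6 / 5 : ℝ) :=
          lintegral_mono hinner
      _ = ENNReal.ofReal 5 * N ^ (2 / 3 : ℝ) * N := lintegral_const_mul _ (by fun_prop)
      _ = _ := by
          rw [mul_assoc]
          congr 1
          nth_rewrite 2 [← ENNReal.rpow_one N]
          rw [← ENNReal.rpow_add _ _ h0 htop]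
          norm_num
  calc ∫⁻ s, ∫⁻ t, G s * (G t * K s t) ≤ ∫⁻ s, ∫⁻ t, (Φ s t + Φ t s) :=
        lintegral_mono fun s => lintegral_mono fun t => hle s t
    _ = (∫⁻ s, ∫⁻ t, Φ s t) + ∫⁻ s, ∫⁻ t, Φ t s := by
        rw [← lintegral_add_left (f := fun s => ∫⁻ t, Φ s t) (Measurable.lintegral_prod_right' hΦ)]
        apply lintegral_congr
        intro s
        exact lintegral_add_left (hΦ.comp measurable_prodMk_left) _
    _ = (∫⁻ s, ∫⁻ t, Φ s t) + ∫⁻ s, ∫⁻ t, Φ s t := by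
        congr 1
        exact (lintegral_lintegral_swap hΦ.aemeasurable).symm
    _ ≤ ENNReal.ofReal 5 * N ^ (5 / 3 : ℝ) + ENNReal.ofReal 5 * N ^ (5 / 3 : ℝ) :=
        add_le_add houter houter
    _ = _ := by
        rw [← add_mul, ← ENNReal.ofReal_add (by norm_num) (by norm_num)]
        norm_num

/-! ### The `TT*` argument along a measurable curve -/

/-- The plane wave `exp (i (2 π x ξ + t P(ξ)))`. -/
noncomputable def planeWave (P : ℝ → ℝ) (t x ξ : ℝ) : ℂ :=
  Complex.exp (Complex.I * (2 * Real.pi * x * ξ + t * P ξ : ℝ))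

theorem norm_planeWave (P : ℝ → ℝ) (t x ξ : ℝ) : ‖planeWave P t x ξ‖ = 1 := by
  rw [planeWave, mul_comm]; exact Complex.norm_exp_ofReal_mul_I _

theorem enorm_planeWave (P : ℝ → ℝ) (t x ξ : ℝ) : ‖planeWave P t x ξ‖ₑ = 1 := by
  rw [← ofReal_norm, norm_planeWave, ENNReal.ofReal_one]

theorem continuous_planeWave {P : ℝ → ℝ} (hP : Continuous P) :
    Continuous fun p : ℝ × ℝ × ℝ => planeWave P p.1 p.2.1 p.2.2 := by
  unfold planeWave; fun_prop

/-- The phase is linear in `(t, x)`. Hence the kernel of `TT*` is the propagator kernel at the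
difference of two space-time points. -/
theorem planeWave_mul_conj (P : ℝ → ℝ) (t x t' x' ξ : ℝ) :
    planeWave P t x ξ * (starRingEnd ℂ) (planeWave P t' x' ξ) =
      planeWave P (t - t') (x - x') ξ := by
  unfold planeWave
  rw [← Complex.exp_conj, ← Complex.exp_add]
  congr 1
  simp only [map_mul, Complex.conj_I, Complex.conj_ofReal]
  push_cast
  ring

/-- The dispersive bound for the propagator with symbol `P`, uniformly in frequency cut-offs. -/
def DispersiveBound (P : ℝ → ℝ) (D : ℝ) : Prop :=
  ∀ a b t x : ℝ, t ≠ 0 → ‖∫ ξ in a..b, planeWave P t x ξ‖ ≤ D * |t| ^ (-(1 / 3) : ℝ)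

/-- Expand the square and integrate in `ξ` first: what remains is a double time integral of `g` and
its conjugate against the truncated propagator kernel at `(s - t, X s - X t)`. The dispersive bound
is uniform in space, so the curve disappears and Hardy–Littlewood–Sobolev applies. -/
theorem lintegral_enorm_sq_dual_le {P : ℝ → ℝ} (hP : Continuous P) {D : ℝ} (hD0 : 0 ≤ D)
    (hD : DispersiveBound P D) {g : ℝ → ℂ} (hg : Measurable g) (hgi : Integrable g)
    {X : ℝ → ℝ} (hX : Measurable X) (R : ℝ) (hR : 0 ≤ R) :
    ∫⁻ ξ in Set.Icc (-R) R, ‖∫ t, planeWave P t (X t) ξ * g t‖ₑ ^ 2 ≤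
      ENNReal.ofReal D * (10 * (∫⁻ t, ‖g t‖ₑ ^ (6 / 5 : ℝ)) ^ (5 / 3 : ℝ)) := by
  set ν := (volume : Measure ℝ).restrict (Set.Icc (-R) R)
  have hWm : Measurable fun p : ℝ × ℝ => planeWave P p.2 (X p.2) p.1 :=
    (continuous_planeWave hP).measurable.comp (by fun_prop : Measurable
      fun p : ℝ × ℝ => (p.2, X p.2, p.1))
  set A : ℝ → ℂ := fun ξ => ∫ t, planeWave P t (X t) ξ * g t
  have hAm : StronglyMeasurable A := by
    apply StronglyMeasurable.integral_prod_right
      (f := fun ξ t => planeWave P t (X t) ξ * g t)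
    exact (hWm.mul (hg.comp measurable_snd)).stronglyMeasurable
  have hAb : ∀ ξ, ‖A ξ‖ ≤ ∫ t, ‖g t‖ := by
    intro ξ
    refine (norm_integral_le_integral_norm _).trans (le_of_eq ?_)
    simp only [norm_mul, norm_planeWave, one_mul]
  have hAi : Integrable (fun ξ => ‖A ξ‖ ^ 2) ν := by
    refine Integrable.of_bound (by fun_prop) ((∫ t, ‖g t‖) ^ 2) (ae_of_all _ fun ξ => ?_)
    rw [Real.norm_of_nonneg (by positivity)]
    exact pow_le_pow_left₀ (norm_nonneg _) (hAb ξ) 2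
  set Q : ℝ → ℝ × ℝ → ℂ := fun ξ z => (planeWave P z.1 (X z.1) ξ * g z.1) *
    (starRingEnd ℂ) (planeWave P z.2 (X z.2) ξ * g z.2)
  have hQm : Measurable (Function.uncurry Q) := by
    apply Measurable.mul
    · exact (hWm.comp (by fun_prop : Measurable fun p : ℝ × ℝ × ℝ => (p.1, p.2.1))).mul
        (hg.comp (by fun_prop))
    · exact Complex.continuous_conj.measurable.comp
        ((hWm.comp (by fun_prop : Measurable fun p : ℝ × ℝ × ℝ => (p.1, p.2.2))).mul
        (hg.comp (by fun_prop)))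
  have hAQ : ∀ ξ, ((‖A ξ‖ ^ 2 : ℝ) : ℂ) = ∫ z, Q ξ z := by
    intro ξ
    rw [Measure.volume_eq_prod]
    simp only [Q]
    rw [integral_prod_mul (fun t => planeWave P t (X t) ξ * g t)
      (fun t => (starRingEnd ℂ) (planeWave P t (X t) ξ * g t)), integral_conj, Complex.mul_conj,
      Complex.normSq_eq_norm_sq]
  have hQi : Integrable (Function.uncurry Q) (ν.prod volume) := by
    have h1 : Integrable (fun p : ℝ × ℝ × ℝ => (1 : ℂ) * (g p.2.1 * g p.2.2)) (ν.prod volume) := by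
      have h2 : Integrable (fun z : ℝ × ℝ => g z.1 * g z.2) volume := hgi.mul_prod hgi
      exact (integrable_const (1 : ℂ)).mul_prod h2
    refine h1.mono hQm.aestronglyMeasurable (ae_of_all _ fun p => le_of_eq ?_)
    simp [Q, Function.uncurry, norm_planeWave]
  have hK : ∀ z : ℝ × ℝ, ∫ ξ, Q ξ z ∂ν = (g z.1 * (starRingEnd ℂ) (g z.2)) *
      ∫ ξ in (-R)..R, planeWave P (z.1 - z.2) (X z.1 - X z.2) ξ := by
    intro z
    rw [intervalIntegral.integral_of_le (by linarith), ← integral_Icc_eq_integral_Ioc,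
      ← integral_const_mul]
    apply integral_congr_ae
    refine ae_of_all _ fun ξ => ?_
    simp only [Q, map_mul, ← planeWave_mul_conj]
    ring
  have e1 : ∫⁻ ξ, ‖A ξ‖ₑ ^ 2 ∂ν = ENNReal.ofReal (∫ ξ, ‖A ξ‖ ^ 2 ∂ν) := by
    rw [ofReal_integral_eq_lintegral_ofReal hAi (ae_of_all _ fun ξ => by positivity)]
    apply lintegral_congr
    intro ξ
    rw [← ofReal_norm, ENNReal.ofReal_pow (norm_nonneg _)]
  have e2 : ((∫ ξ, ‖A ξ‖ ^ 2 ∂ν : ℝ) : ℂ) = ∫ z : ℝ × ℝ, (g z.1 * (starRingEnd ℂ) (g z.2)) *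
      ∫ ξ in (-R)..R, planeWave P (z.1 - z.2) (X z.1 - X z.2) ξ := by
    rw [← integral_complex_ofReal]
    simp_rw [hAQ]
    rw [integral_integral_swap hQi]
    simp_rw [hK]
  have e3 : ENNReal.ofReal (∫ ξ, ‖A ξ‖ ^ 2 ∂ν) ≤ ‖((∫ ξ, ‖A ξ‖ ^ 2 ∂ν : ℝ) : ℂ)‖ₑ := by
    rw [← ofReal_norm, Complex.norm_real]
    exact ENNReal.ofReal_le_ofReal (le_abs_self _)
  set k : ℝ × ℝ → ℝ≥0∞ := fun z => ‖g z.1‖ₑ * (‖g z.2‖ₑ *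
      ENNReal.ofReal (|z.2 - z.1| ^ (-(1 / 3) : ℝ)))
  have hkm : Measurable k := by
    simp only [k]; fun_prop
  -- On the diagonal `0 ^ (-1/3)` has the value `0`, so the dispersive bound is usable only off this
  -- null set.
  have hne : ∀ᵐ z : ℝ × ℝ, z.1 ≠ z.2 := by
    rw [Measure.volume_eq_prod]
    rw [Measure.ae_prod_iff_ae_ae (p := fun z : ℝ × ℝ => z.1 ≠ z.2)
      (measurableSet_eq_fun measurable_fst measurable_snd).compl]
    refine ae_of_all _ fun s => ?_
    filter_upwards [Measure.ae_ne volume s] with t ht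
    exact ht.symm
  calc ∫⁻ ξ, ‖A ξ‖ₑ ^ 2 ∂ν ≤ ‖((∫ ξ, ‖A ξ‖ ^ 2 ∂ν : ℝ) : ℂ)‖ₑ := e1 ▸ e3
    _ ≤ ∫⁻ z : ℝ × ℝ, ‖(g z.1 * (starRingEnd ℂ) (g z.2)) *
      ∫ ξ in (-R)..R, planeWave P (z.1 - z.2) (X z.1 - X z.2) ξ‖ₑ := by
        rw [e2]; exact enorm_integral_le_lintegral_enorm _
    _ ≤ ∫⁻ z : ℝ × ℝ, ENNReal.ofReal D * k z := by
        apply lintegral_mono_ae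
        filter_upwards [hne] with z hz
        have hb := hD (-R) R (z.1 - z.2) (X z.1 - X z.2) (sub_ne_zero.2 hz)
        have hb' : ‖∫ ξ in (-R)..R, planeWave P (z.1 - z.2) (X z.1 - X z.2) ξ‖ₑ ≤
            ENNReal.ofReal D * ENNReal.ofReal (|z.2 - z.1| ^ (-(1 / 3) : ℝ)) := by
          rw [← ENNReal.ofReal_mul hD0, ← ofReal_norm, abs_sub_comm]
          exact ENNReal.ofReal_le_ofReal hb
        rw [enorm_mul, enorm_mul, RCLike.enorm_conj]
        calc _ ≤ ‖g z.1‖ₑ * ‖g z.2‖ₑ *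
              (ENNReal.ofReal D * ENNReal.ofReal (|z.2 - z.1| ^ (-(1 / 3) : ℝ))) := by gcongr
          _ = _ := by simp only [k]; ring
    _ = ENNReal.ofReal D * ∫⁻ s, ∫⁻ t, ‖g s‖ₑ * (‖g t‖ₑ *
          ENNReal.ofReal (|t - s| ^ (-(1 / 3) : ℝ))) := by
        rw [lintegral_const_mul _ hkm, Measure.volume_eq_prod, lintegral_prod _ hkm.aemeasurable]
    _ ≤ _ := by
        gcongr
        exact lintegral_lintegral_mul_abs_sub_rpow_le hg.enorm (fun t => by simp)

/-- The superposition of plane waves with frequencies in `[-R, R]` and amplitude `b`. -/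
noncomputable def waveSum (P : ℝ → ℝ) (R : ℝ) (b : ℝ → ℂ) (t x : ℝ) : ℂ :=
  ∫ ξ in Set.Icc (-R) R, planeWave P t x ξ * b ξ

theorem norm_waveSum_le (P : ℝ → ℝ) (R : ℝ) (b : ℝ → ℂ) (t x : ℝ) :
    ‖waveSum P R b t x‖ ≤ ∫ ξ in Set.Icc (-R) R, ‖b ξ‖ := by
  refine (norm_integral_le_integral_norm _).trans (le_of_eq ?_)
  simp only [norm_mul, norm_planeWave, one_mul]

theorem continuous_waveSum {P : ℝ → ℝ} (hP : Continuous P) {R : ℝ} {b : ℝ → ℂ}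
    (hb : IntegrableOn b (Set.Icc (-R) R)) :
    Continuous fun p : ℝ × ℝ => waveSum P R b p.1 p.2 := by
  apply continuous_of_dominated (bound := fun ξ => ‖b ξ‖)
  · intro p
    exact AEStronglyMeasurable.mul (((continuous_planeWave hP).comp
      (by fun_prop : Continuous fun ξ => (p.1, p.2, ξ))).aestronglyMeasurable)
      hb.aestronglyMeasurable
  · intro p
    exact ae_of_all _ fun ξ => by simp [norm_planeWave]
  · exact hb.norm
  · refine ae_of_all _ fun ξ => ?_
    exact ((continuous_planeWave hP).comp
      (by fun_prop : Continuous fun p : ℝ × ℝ => (p.1, p.2, ξ))).mul continuous_const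

theorem measurable_waveSum_curve {P : ℝ → ℝ} (hP : Continuous P) {R : ℝ} {b : ℝ → ℂ}
    (hb : IntegrableOn b (Set.Icc (-R) R)) {X : ℝ → ℝ} (hX : Measurable X) :
    Measurable fun t => waveSum P R b t (X t) := by
  have h := (continuous_waveSum hP hb).measurable
  have h2 : Measurable fun t => (t, X t) := measurable_id.prodMk hX
  exact Measurable.comp (g := fun p : ℝ × ℝ => waveSum P R b p.1 p.2) (f := fun t => (t, X t)) h h2

/-- The Strichartz estimate along a measurable curve. -/
theorem lintegral_waveSum_curve_le {P : ℝ → ℝ} (hP : Continuous P) {D : ℝ} (hD0 : 0 ≤ D)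
    (hD : DispersiveBound P D) {R : ℝ} (hR : 0 ≤ R) {b : ℝ → ℂ}
    (hb : IntegrableOn b (Set.Icc (-R) R)) {X : ℝ → ℝ} (hX : Measurable X) (T : ℝ) :
    ∫⁻ t in Set.Icc (-T) T, ‖waveSum P R b t (X t)‖ₑ ^ (6 : ℝ) ≤
      (ENNReal.ofReal D * 10) ^ (3 : ℝ) * (∫⁻ ξ in Set.Icc (-R) R, ‖b ξ‖ₑ ^ 2) ^ (3 : ℝ) := by
  set ν := (volume : Measure ℝ).restrict (Set.Icc (-R) R)
  set U : ℝ → ℂ := fun t => waveSum P R b t (X t)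
  have hU : Measurable U := measurable_waveSum_curve hP hb hX
  set M := ∫ ξ in Set.Icc (-R) R, ‖b ξ‖
  have hUM : ∀ t, ‖U t‖ ≤ M := fun t => norm_waveSum_le P R b t (X t)
  -- The extremizer of `L⁶`–`L^(6/5)` duality: on the window, `g U = |U| ^ 6` and `|g| ^ (6/5) = |U|
  -- ^ 6`.
  set g : ℝ → ℂ := (Set.Icc (-T) T).indicator fun t => (starRingEnd ℂ) (U t) * (‖U t‖ : ℂ) ^ 4
  have hg : Measurable g := by
    refine Measurable.indicator ?_ measurableSet_Icc
    exact (Complex.continuous_conj.measurable.comp hU).mul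
      ((Complex.measurable_ofReal.comp hU.norm).pow_const 4)
  have hgi : Integrable g := by
    refine IntegrableOn.integrable_indicator ?_ measurableSet_Icc
    refine Integrable.of_bound ?_ (M ^ 5) (ae_of_all _ fun t => ?_)
    · exact ((Complex.continuous_conj.measurable.comp hU).mul
        ((Complex.measurable_ofReal.comp hU.norm).pow_const 4)).aestronglyMeasurable
    · rw [norm_mul, RCLike.norm_conj, norm_pow, Complex.norm_real, norm_norm, ← pow_succ']
      exact pow_le_pow_left₀ (norm_nonneg _) (hUM t) 5
  have hgU : ∀ t, g t * U t = ((Set.Icc (-T) T).indicator (fun t => ‖U t‖ ^ 6) t : ℝ) := by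
    intro t
    by_cases ht : t ∈ Set.Icc (-T) T
    · simp only [g, Set.indicator_of_mem ht]
      rw [mul_right_comm, mul_comm ((starRingEnd ℂ) _), Complex.mul_conj, Complex.normSq_eq_norm_sq]
      push_cast; ring
    · simp [g, Set.indicator_of_notMem ht]
  set J := ∫⁻ t in Set.Icc (-T) T, ‖U t‖ₑ ^ (6 : ℝ)
  -- Finiteness permits the later division by `J ^ (5/6)`; it comes from the bounded time window and
  -- the boundedness of `U`.
  have hJfin : J ≠ ∞ := by
    have : J ≤ ∫⁻ t in Set.Icc (-T) T, ENNReal.ofReal M ^ (6 : ℝ) := by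
      apply lintegral_mono
      intro t
      simp only
      rw [← ofReal_norm]
      gcongr
      exact hUM t
    refine ne_top_of_le_ne_top ?_ this
    rw [setLIntegral_const]
    exact ENNReal.mul_ne_top (ENNReal.rpow_ne_top_of_nonneg (by norm_num) ENNReal.ofReal_ne_top)
      (by simp)
  have hgJ : ∫⁻ t, ‖g t‖ₑ ^ (6 / 5 : ℝ) = J := by
    simp only [J]
    rw [← lintegral_indicator measurableSet_Icc]
    apply lintegral_congr
    intro t
    by_cases ht : t ∈ Set.Icc (-T) T
    · simp only [g, Set.indicator_of_mem ht]
      rw [enorm_mul, RCLike.enorm_conj, enorm_pow]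
      have : ‖((‖U t‖ : ℝ) : ℂ)‖ₑ = ‖U t‖ₑ := by
        rw [← ofReal_norm, Complex.norm_real, norm_norm, ofReal_norm]
      rw [this, ← pow_succ', ← ENNReal.rpow_natCast, ← ENNReal.rpow_mul]
      norm_num
    · simp [g, Set.indicator_of_notMem ht]
  have hJeq : J = ‖∫ t, g t * U t‖ₑ := by
    simp_rw [hgU]
    rw [integral_complex_ofReal, ← ofReal_norm, Complex.norm_real,
      integral_indicator measurableSet_Icc,
      Real.norm_of_nonneg (integral_nonneg fun t => by positivity),
      ofReal_integral_eq_lintegral_ofReal]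
    · apply lintegral_congr
      intro t
      rw [ENNReal.ofReal_pow (norm_nonneg _), ofReal_norm, ← ENNReal.rpow_natCast]
      norm_num
    · refine Integrable.of_bound (by fun_prop) (M ^ 6) (ae_of_all _ fun t => ?_)
      rw [Real.norm_of_nonneg (by positivity)]
      exact pow_le_pow_left₀ (norm_nonneg _) (hUM t) 6
    · exact ae_of_all _ fun t => by positivity
  have hWm : Measurable fun p : ℝ × ℝ => planeWave P p.1 (X p.1) p.2 :=
    (continuous_planeWave hP).measurable.comp (by fun_prop : Measurable
      fun p : ℝ × ℝ => (p.1, X p.1, p.2))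
  have hswap : ∫ t, g t * U t = ∫ ξ, b ξ * (∫ t, planeWave P t (X t) ξ * g t) ∂ν := by
    have h1 : ∀ t, g t * U t = ∫ ξ, g t * (planeWave P t (X t) ξ * b ξ) ∂ν := fun t => by
      rw [integral_const_mul]; rfl
    simp_rw [h1]
    rw [integral_integral_swap]
    · apply integral_congr_ae
      refine ae_of_all _ fun ξ => ?_
      simp only
      rw [← integral_const_mul]
      congr 1
      ext t
      ring
    · have hgb : Integrable (fun p : ℝ × ℝ => g p.1 * b p.2) (volume.prod ν) := hgi.mul_prod hb
      refine hgb.mono ?_ (ae_of_all _ fun p => ?_)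
      · have : (Function.uncurry fun t ξ => g t * (planeWave P t (X t) ξ * b ξ)) =
            fun p : ℝ × ℝ => planeWave P p.1 (X p.1) p.2 * (g p.1 * b p.2) := by
          ext p; simp only [Function.uncurry]; ring
        rw [this]
        exact hWm.aestronglyMeasurable.mul hgb.aestronglyMeasurable
      · simp [Function.uncurry, norm_planeWave]
  have hAm : AEMeasurable (fun ξ => ‖∫ t, planeWave P t (X t) ξ * g t‖ₑ) ν := by
    have : StronglyMeasurable fun ξ => ∫ t, planeWave P t (X t) ξ * g t := by
      apply StronglyMeasurable.integral_prod_right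
        (f := fun ξ t => planeWave P t (X t) ξ * g t)
      exact ((hWm.comp measurable_swap).mul (hg.comp measurable_snd)).stronglyMeasurable
    exact this.enorm.aemeasurable
  set B := ∫⁻ ξ, ‖b ξ‖ₑ ^ 2 ∂ν
  have hJle : J ≤ B ^ (1 / 2 : ℝ) *
      (ENNReal.ofReal D * (10 * J ^ (5 / 3 : ℝ))) ^ (1 / 2 : ℝ) := by
    calc J = ‖∫ ξ, b ξ * (∫ t, planeWave P t (X t) ξ * g t) ∂ν‖ₑ := by rw [hJeq, hswap]
      _ ≤ ∫⁻ ξ, ‖b ξ‖ₑ * ‖∫ t, planeWave P t (X t) ξ * g t‖ₑ ∂ν := by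
          refine (enorm_integral_le_lintegral_enorm _).trans (le_of_eq ?_)
          simp_rw [enorm_mul]
      _ ≤ (∫⁻ ξ, ‖b ξ‖ₑ ^ (2 : ℝ) ∂ν) ^ (1 / 2 : ℝ) *
            (∫⁻ ξ, ‖∫ t, planeWave P t (X t) ξ * g t‖ₑ ^ (2 : ℝ) ∂ν) ^ (1 / 2 : ℝ) :=
          ENNReal.lintegral_mul_le_Lp_mul_Lq _ (by
            rw [Real.holderConjugate_iff]; norm_num) hb.aestronglyMeasurable.enorm hAm
      _ ≤ _ := by
          simp only [ENNReal.rpow_two]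
          gcongr
          rw [← hgJ]
          exact lintegral_enorm_sq_dual_le hP hD0 hD hg hgi hX R hR
  rcases eq_or_ne J 0 with h0 | h0
  · rw [h0]; exact zero_le
  have h56 : J ^ (5 / 6 : ℝ) ≠ 0 := by
    simp [ENNReal.rpow_eq_zero_iff, h0, hJfin]
  have h56' : J ^ (5 / 6 : ℝ) ≠ ∞ := ENNReal.rpow_ne_top_of_nonneg (by norm_num) hJfin
  -- Divide `J ≤ (10 D B) ^ (1/2) J ^ (5/6)` by `J ^ (5/6)`.
  have hle : J ^ (1 / 6 : ℝ) ≤ (ENNReal.ofReal D * 10 * B) ^ (1 / 2 : ℝ) := by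
    rw [← ENNReal.mul_le_mul_iff_left h56 h56', ← ENNReal.rpow_add _ _ h0 hJfin]
    norm_num
    refine hJle.trans (le_of_eq ?_)
    rw [← mul_assoc (ENNReal.ofReal D), ENNReal.mul_rpow_of_nonneg _ (J ^ (5 / 3 : ℝ)) (by norm_num),
      ENNReal.mul_rpow_of_nonneg _ B (by norm_num), ← ENNReal.rpow_mul]
    norm_num
    ring
  calc J = (J ^ (1 / 6 : ℝ)) ^ (6 : ℝ) := by rw [← ENNReal.rpow_mul]; norm_num
    _ ≤ ((ENNReal.ofReal D * 10 * B) ^ (1 / 2 : ℝ)) ^ (6 : ℝ) := by gcongr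
    _ = _ := by
        rw [← ENNReal.rpow_mul, ← ENNReal.mul_rpow_of_nonneg _ _ (by norm_num)]
        norm_num

/-! ### From curves to the spatial supremum -/

/-- A measurable curve of almost maximal points. -/
theorem exists_measurable_almost_argmax {v : ℝ → ℝ → ℝ} (hm : ∀ x, Measurable fun t => v t x)
    (hc : ∀ t, Continuous (v t)) (h0 : ∀ t x, 0 ≤ v t x) (hb : ∀ t, BddAbove (Set.range (v t))) :
    ∃ X : ℝ → ℝ, Measurable X ∧ ∀ t x, v t x ≤ 2 * v t (X t) := by
  classical
  set q := TopologicalSpace.denseSeq ℝ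
  set S : ℝ → ℝ := fun t => ⨆ n, v t (q n)
  have hbq : ∀ t, BddAbove (Set.range fun n => v t (q n)) := fun t =>
    (hb t).mono (Set.range_comp_subset_range q (v t))
  have hS : Measurable S := Measurable.iSup fun n => hm (q n)
  have hvS : ∀ t x, v t x ≤ S t := by
    intro t x
    have hd : x ∈ closure (Set.range q) := TopologicalSpace.denseRange_denseSeq ℝ x
    have hcl : IsClosed {x | v t x ≤ S t} := isClosed_le (hc t) continuous_const
    refine hcl.closure_subset_iff.2 ?_ hd
    rintro _ ⟨n, rfl⟩
    exact le_ciSup (hbq t) n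
  have hex : ∀ t, ∃ n, S t ≤ 2 * v t (q n) := by
    intro t
    rcases le_or_gt (S t) 0 with h | h
    · exact ⟨0, h.trans (mul_nonneg zero_le_two (h0 _ _))⟩
    · obtain ⟨n, hn⟩ := exists_lt_of_lt_ciSup (show S t / 2 < S t by linarith)
      exact ⟨n, by linarith⟩
  -- Taking the least admissible index in a dense sequence makes the selection measurable.
  refine ⟨fun t => q (Nat.find (hex t)), ?_, fun t x => (hvS t x).trans (Nat.find_spec (hex t))⟩
  exact (measurable_from_nat (f := q)).comp
    (measurable_find hex fun n => measurableSet_le hS ((hm (q n)).const_mul 2))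

/-- The endpoint Strichartz estimate for frequency-localized data: the function of time `m`
dominates the spatial supremum. -/
theorem exists_measurable_bound_waveSum {P : ℝ → ℝ} (hP : Continuous P) {D : ℝ} (hD0 : 0 ≤ D)
    (hD : DispersiveBound P D) {R : ℝ} (hR : 0 ≤ R) {b : ℝ → ℂ}
    (hb : IntegrableOn b (Set.Icc (-R) R)) :
    ∃ m : ℝ → ℝ≥0∞, Measurable m ∧ (∀ t x, ‖waveSum P R b t x‖ₑ ≤ m t) ∧
      ∀ T, ∫⁻ t in Set.Icc (-T) T, m t ^ (6 : ℝ) ≤ 2 ^ (6 : ℝ) *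
        ((ENNReal.ofReal D * 10) ^ (3 : ℝ) * (∫⁻ ξ in Set.Icc (-R) R, ‖b ξ‖ₑ ^ 2) ^ (3 : ℝ)) := by
  have hcont := continuous_waveSum hP hb
  obtain ⟨X, hX, hmax⟩ := exists_measurable_almost_argmax
    (v := fun t x => ‖waveSum P R b t x‖)
    (fun x => (measurable_waveSum_curve hP hb measurable_const).norm)
    (fun t => (hcont.comp (by fun_prop : Continuous fun x : ℝ => (t, x))).norm)
    (fun t x => norm_nonneg _)
    (fun t => ⟨_, by rintro _ ⟨x, rfl⟩; exact norm_waveSum_le P R b t x⟩)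
  have hU : Measurable fun t => waveSum P R b t (X t) := measurable_waveSum_curve hP hb hX
  refine ⟨fun t => 2 * ‖waveSum P R b t (X t)‖ₑ, by fun_prop, fun t x => ?_, fun T => ?_⟩
  · simp only
    rw [← ofReal_norm, ← ofReal_norm, ← ENNReal.ofReal_ofNat, ← ENNReal.ofReal_mul (by norm_num)]
    exact ENNReal.ofReal_le_ofReal (hmax t x)
  · simp_rw [ENNReal.mul_rpow_of_nonneg _ _ (show (0 : ℝ) ≤ 6 by norm_num)]
    rw [lintegral_const_mul _ (by fun_prop)]
    gcongr
    exact lintegral_waveSum_curve_le hP hD0 hD hR hb hX T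

/-! ### Bounded multipliers on `L²`: evolution and frequency cut-off -/

theorem memLp_mul_of_norm_le_one {m : ℝ → ℂ} (hm : Measurable m) (hb : ∀ ξ, ‖m ξ‖ ≤ 1)
    (f : Lp ℂ 2 (volume : Measure ℝ)) : MemLp (fun ξ => m ξ * f ξ) 2 :=
  (Lp.memLp f).of_le (hm.aestronglyMeasurable.mul (Lp.aestronglyMeasurable f))
    (ae_of_all _ fun ξ => by
      rw [norm_mul]; exact mul_le_of_le_one_left (norm_nonneg _) (hb ξ))

/-- Multiplication by a measurable function bounded by `1`, as an operator on `L²`. -/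
noncomputable def mulL2 (m : ℝ → ℂ) (hm : Measurable m) (hb : ∀ ξ, ‖m ξ‖ ≤ 1) :
    Lp ℂ 2 (volume : Measure ℝ) →L[ℂ] Lp ℂ 2 (volume : Measure ℝ) :=
  have hmem := memLp_mul_of_norm_le_one hm hb
  LinearMap.mkContinuous
    { toFun := fun f => (hmem f).toLp
      map_add' := fun f g => by
        apply Lp.ext
        filter_upwards [(hmem (f + g)).coeFn_toLp, (hmem f).coeFn_toLp, (hmem g).coeFn_toLp,
          Lp.coeFn_add f g, Lp.coeFn_add (hmem f).toLp (hmem g).toLp] with ξ h1 h2 h3 h4 h5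
        rw [h1, h5, Pi.add_apply, h2, h3, h4, Pi.add_apply, mul_add]
      map_smul' := fun c f => by
        apply Lp.ext
        filter_upwards [(hmem (c • f)).coeFn_toLp, (hmem f).coeFn_toLp,
          Lp.coeFn_smul c f, Lp.coeFn_smul c (hmem f).toLp] with ξ h1 h2 h3 h4
        simp only [RingHom.id_apply]
        rw [h1, h4, Pi.smul_apply, h2, h3, Pi.smul_apply, smul_eq_mul, smul_eq_mul,
          mul_left_comm] }
    1 (fun f => by
      rw [one_mul]
      apply Lp.norm_le_norm_of_ae_le
      filter_upwards [(hmem f).coeFn_toLp] with ξ h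
      simp only [LinearMap.coe_mk, AddHom.coe_mk]
      rw [h, norm_mul]
      exact mul_le_of_le_one_left (norm_nonneg _) (hb ξ))

theorem coeFn_mulL2 {m : ℝ → ℂ} (hm : Measurable m) (hb : ∀ ξ, ‖m ξ‖ ≤ 1)
    (f : Lp ℂ 2 (volume : Measure ℝ)) : mulL2 m hm hb f =ᵐ[volume] fun ξ => m ξ * f ξ :=
  (memLp_mul_of_norm_le_one hm hb f).coeFn_toLp

theorem norm_mulL2_le {m : ℝ → ℂ} (hm : Measurable m) (hb : ∀ ξ, ‖m ξ‖ ≤ 1)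
    (f : Lp ℂ 2 (volume : Measure ℝ)) : ‖mulL2 m hm hb f‖ ≤ ‖f‖ := by
  apply Lp.norm_le_norm_of_ae_le
  filter_upwards [coeFn_mulL2 hm hb f] with ξ h
  rw [h, norm_mul]
  exact mul_le_of_le_one_left (norm_nonneg _) (hb ξ)

/-- Dominated convergence with majorant `4 |f| ^ 2`. It yields strong continuity of the evolution,
convergence of the cut-offs, and differentiability of the group on Schwartz functions. -/
theorem tendsto_mulL2 {ι : Type*} {l : Filter ι} [l.IsCountablyGenerated] {m : ι → ℝ → ℂ}
    (hm : ∀ i, Measurable (m i)) (hb : ∀ i ξ, ‖m i ξ‖ ≤ 1) {m₀ : ℝ → ℂ} (hm₀ : Measurable m₀)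
    (hb₀ : ∀ ξ, ‖m₀ ξ‖ ≤ 1) (hlim : ∀ ξ, Tendsto (fun i => m i ξ) l (𝓝 (m₀ ξ)))
    (f : Lp ℂ 2 (volume : Measure ℝ)) :
    Tendsto (fun i => mulL2 (m i) (hm i) (hb i) f) l (𝓝 (mulL2 m₀ hm₀ hb₀ f)) := by
  rw [tendsto_iff_edist_tendsto_0]
  have he : ∀ i, edist (mulL2 (m i) (hm i) (hb i) f) (mulL2 m₀ hm₀ hb₀ f) =
      (∫⁻ ξ, ‖(m i ξ - m₀ ξ) * f ξ‖ₑ ^ (2 : ℝ)) ^ (1 / 2 : ℝ) := by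
    intro i
    rw [Lp.edist_def, eLpNorm_eq_lintegral_rpow_enorm_toReal (by norm_num) (by norm_num)]
    simp only [ENNReal.toReal_ofNat]
    congr 1
    apply lintegral_congr_ae
    filter_upwards [coeFn_mulL2 (hm i) (hb i) f, coeFn_mulL2 hm₀ hb₀ f] with ξ h1 h2
    rw [Pi.sub_apply, h1, h2, sub_mul]
  simp_rw [he]
  have h0 : Tendsto (fun i => ∫⁻ ξ, ‖(m i ξ - m₀ ξ) * f ξ‖ₑ ^ (2 : ℝ)) l (𝓝 (∫⁻ _ : ℝ, 0)) := by
    have hfin : ∫⁻ ξ, ‖f ξ‖ₑ ^ (2 : ℝ) ≠ ∞ := by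
      have := lintegral_rpow_enorm_lt_top_of_eLpNorm_lt_top (p := 2) (by norm_num) (by norm_num)
        (Lp.eLpNorm_lt_top f)
      simpa using this.ne
    apply tendsto_lintegral_filter_of_dominated_convergence
      (fun ξ => 2 ^ (2 : ℝ) * ‖f ξ‖ₑ ^ (2 : ℝ))
    · refine Eventually.of_forall fun i => ?_
      have hf : Measurable f := (Lp.stronglyMeasurable f).measurable
      have := hm i
      fun_prop
    · refine Eventually.of_forall fun i => ae_of_all _ fun ξ => ?_
      rw [enorm_mul, ← ENNReal.mul_rpow_of_nonneg _ _ (by norm_num)]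
      gcongr
      rw [← ofReal_norm, ← ENNReal.ofReal_ofNat]
      apply ENNReal.ofReal_le_ofReal
      refine (norm_sub_le _ _).trans ?_
      linarith [hb i ξ, hb₀ ξ]
    · rw [lintegral_const_mul' _ _ (by norm_num)]
      exact ENNReal.mul_ne_top (by norm_num) hfin
    · refine ae_of_all _ fun ξ => ?_
      have h1 : Tendsto (fun i => (m i ξ - m₀ ξ) * f ξ) l (𝓝 0) := by
        have := ((hlim ξ).sub_const (m₀ ξ)).mul_const (f ξ)
        simpa using this
      have h2 := (ENNReal.continuous_rpow_const (y := 2)).tendsto _ |>.comp h1.enorm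
      simpa [Function.comp_def] using h2
  rw [lintegral_zero] at h0
  have h2 := (ENNReal.continuous_rpow_const (y := 1 / 2)).tendsto _ |>.comp h0
  simpa [Function.comp_def] using h2

theorem measurable_planeWave {P : ℝ → ℝ} (hP : Continuous P) (t x : ℝ) :
    Measurable (planeWave P t x) := by
  unfold planeWave; fun_prop

/-- The free evolution on the Fourier side. -/
noncomputable def evolve (P : ℝ → ℝ) (hP : Continuous P) (t : ℝ) :
    Lp ℂ 2 (volume : Measure ℝ) →L[ℂ] Lp ℂ 2 (volume : Measure ℝ) :=
  mulL2 (planeWave P t 0) (measurable_planeWave hP t 0) (fun ξ => (norm_planeWave P t 0 ξ).le)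

theorem coeFn_evolve {P : ℝ → ℝ} (hP : Continuous P) (t : ℝ) (f : Lp ℂ 2 (volume : Measure ℝ)) :
    evolve P hP t f =ᵐ[volume] fun ξ => planeWave P t 0 ξ * f ξ := coeFn_mulL2 _ _ f

theorem norm_evolve_le {P : ℝ → ℝ} (hP : Continuous P) (t : ℝ)
    (f : Lp ℂ 2 (volume : Measure ℝ)) : ‖evolve P hP t f‖ ≤ ‖f‖ := norm_mulL2_le _ _ f

theorem continuous_evolve {P : ℝ → ℝ} (hP : Continuous P) (f : Lp ℂ 2 (volume : Measure ℝ)) :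
    Continuous fun t => evolve P hP t f := by
  rw [continuous_iff_continuousAt]
  intro t₀
  refine tendsto_mulL2 (fun t => measurable_planeWave hP t 0)
    (fun t ξ => (norm_planeWave P t 0 ξ).le) _ _ (fun ξ => ?_) f
  have : Continuous fun t => planeWave P t 0 ξ := by unfold planeWave; fun_prop
  exact this.tendsto t₀

/-- The sharp frequency cut-off to `[-R, R]`. -/
noncomputable def cutoff (R : ℝ) : Lp ℂ 2 (volume : Measure ℝ) →L[ℂ] Lp ℂ 2 (volume : Measure ℝ) :=
  mulL2 ((Set.Icc (-R) R).indicator 1) (measurable_one.indicator measurableSet_Icc)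
    (fun ξ => by
      refine (norm_indicator_le_norm_self _ _).trans ?_
      simp)

theorem coeFn_cutoff (R : ℝ) (f : Lp ℂ 2 (volume : Measure ℝ)) :
    cutoff R f =ᵐ[volume] (Set.Icc (-R) R).indicator f := by
  filter_upwards [coeFn_mulL2 (measurable_one.indicator measurableSet_Icc) _ f] with ξ h
  refine h.trans ?_
  by_cases hξ : ξ ∈ Set.Icc (-R) R <;> simp [hξ]

theorem norm_cutoff_le (R : ℝ) (f : Lp ℂ 2 (volume : Measure ℝ)) : ‖cutoff R f‖ ≤ ‖f‖ :=
  norm_mulL2_le _ _ f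

theorem tendsto_cutoff (f : Lp ℂ 2 (volume : Measure ℝ)) :
    Tendsto (fun n : ℕ => cutoff n f) atTop (𝓝 f) := by
  have h1 : mulL2 1 measurable_one (fun ξ => by simp) f = f := by
    apply Lp.ext
    filter_upwards [coeFn_mulL2 (m := 1) measurable_one (fun ξ => by simp) f] with ξ h
    simpa using h
  conv => rhs; rw [← h1]
  refine tendsto_mulL2 _ _ _ _ (fun ξ => ?_) f
  obtain ⟨N, hN⟩ := exists_nat_ge |ξ|
  refine tendsto_const_nhds.congr' ?_
  filter_upwards [eventually_ge_atTop N] with n hn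
  have : ξ ∈ Set.Icc (-(n : ℝ)) n := by
    rw [Set.mem_Icc, ← abs_le]
    exact hN.trans (by exact_mod_cast hn)
  rw [Set.indicator_of_mem this]

theorem integrableOn_Lp_two (R : ℝ) (f : Lp ℂ 2 (volume : Measure ℝ)) :
    IntegrableOn f (Set.Icc (-R) R) :=
  ((Lp.memLp f).restrict _).integrable (by norm_num)

theorem waveSum_congr (P : ℝ → ℝ) (R : ℝ) {b b' : ℝ → ℂ} (h : b =ᵐ[volume] b') (t x : ℝ) :
    waveSum P R b t x = waveSum P R b' t x := by
  apply integral_congr_ae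
  filter_upwards [ae_restrict_of_ae h] with ξ hξ
  rw [hξ]

theorem waveSum_evolve {P : ℝ → ℝ} (hP : Continuous P) (R : ℝ)
    (f : Lp ℂ 2 (volume : Measure ℝ)) (t x : ℝ) :
    waveSum 0 R (evolve P hP t f) 0 x = waveSum P R f t x := by
  apply integral_congr_ae
  filter_upwards [ae_restrict_of_ae (coeFn_evolve hP t f)] with ξ hξ
  rw [hξ, ← mul_assoc]
  congr 1
  unfold planeWave
  rw [← Complex.exp_add]
  congr 1
  push_cast
  simp
  ring

theorem continuous_waveSum_zero {R : ℝ} {b : ℝ → ℂ} (hb : IntegrableOn b (Set.Icc (-R) R)) :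
    Continuous (waveSum 0 R b 0) := by
  have h := continuous_waveSum (P := 0) continuous_const hb
  have h2 : Continuous fun x : ℝ => ((0 : ℝ), x) := by fun_prop
  exact Continuous.comp (g := fun p : ℝ × ℝ => waveSum 0 R b p.1 p.2) h h2

/-! ### Frequency-localized waves in `L^r` -/

/-- Fubini puts the inverse Fourier transform on `φ`. This identifies the pointwise integral
`waveSum` with the inverse transform on `L²`, which is defined only almost everywhere. -/
theorem integral_smul_waveSum (R : ℝ) (f : Lp ℂ 2 (volume : Measure ℝ)) (φ : 𝓢(ℝ, ℂ)) :
    ∫ x, φ x • waveSum 0 R f 0 x = ∫ x, φ x • (𝓕⁻ (cutoff R f) : Lp ℂ 2 (volume : Measure ℝ)) x := by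
  have hf := integrableOn_Lp_two R f
  rw [← Lp.toTemperedDistribution_apply, ← Lp.fourierInv_toTemperedDistribution_eq,
    TemperedDistribution.fourierInv_apply, Lp.toTemperedDistribution_apply]
  have h1 : ∀ x, φ x • waveSum 0 R f 0 x =
      ∫ ξ in Set.Icc (-R) R, φ x * (planeWave 0 0 x ξ * f ξ) := fun x => by
    rw [integral_const_mul]; rfl
  simp_rw [h1]
  rw [integral_integral_swap]
  · have h2 : ∀ᵐ ξ, (𝓕⁻ φ : 𝓢(ℝ, ℂ)) ξ • cutoff R f ξ =
        (Set.Icc (-R) R).indicator (fun ξ => ∫ x, φ x * (planeWave 0 0 x ξ * f ξ)) ξ := by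
      filter_upwards [coeFn_cutoff R f] with ξ hξ
      rw [hξ]
      by_cases h : ξ ∈ Set.Icc (-R) R
      · rw [Set.indicator_of_mem h, Set.indicator_of_mem h, SchwartzMap.fourierInv_coe,
          Real.fourierInv_eq', smul_eq_mul, ← integral_mul_const]
        congr 1
        ext x
        rw [smul_eq_mul, planeWave]
        have : (2 * Real.pi * inner ℝ x ξ : ℝ) = 2 * Real.pi * x * ξ + 0 * (0 : ℝ → ℝ) ξ := by
          simp; ring
        rw [this]
        ring_nf
      · rw [Set.indicator_of_notMem h, Set.indicator_of_notMem h, smul_zero]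
    rw [integral_congr_ae h2, integral_indicator measurableSet_Icc]
  · have hgb : Integrable (fun p : ℝ × ℝ => φ p.1 * f p.2)
        (volume.prod (volume.restrict (Set.Icc (-R) R))) := φ.integrable.mul_prod hf
    refine hgb.mono ?_ (ae_of_all _ fun p => ?_)
    · have : (Function.uncurry fun x ξ => φ x * (planeWave 0 0 x ξ * f ξ)) =
          fun p : ℝ × ℝ => planeWave 0 0 p.1 p.2 * (φ p.1 * f p.2) := by
        ext p; simp only [Function.uncurry]; ring
      rw [this]
      have hc : Continuous fun p : ℝ × ℝ => planeWave 0 0 p.1 p.2 := by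
        unfold planeWave; simp only [Pi.zero_apply]; fun_prop
      exact hc.aestronglyMeasurable.mul hgb.aestronglyMeasurable
    · simp [Function.uncurry, norm_planeWave]

theorem waveSum_ae_eq (R : ℝ) (f : Lp ℂ 2 (volume : Measure ℝ)) :
    waveSum 0 R f 0 =ᵐ[volume] (𝓕⁻ (cutoff R f) : Lp ℂ 2 (volume : Measure ℝ)) := by
  apply ae_eq_of_integral_contDiff_smul_eq
  · exact (continuous_waveSum_zero (integrableOn_Lp_two R f)).locallyIntegrable
  · exact (Lp.memLp _).locallyIntegrable (by norm_num)
  · intro g hg hc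
    have h₁ : HasCompactSupport (Complex.ofRealCLM ∘ g) := hc.comp_left rfl
    have h₂ : ContDiff ℝ ((⊤ : ℕ∞) : WithTop ℕ∞) (Complex.ofRealCLM ∘ g) := by fun_prop
    simpa using integral_smul_waveSum R f (h₁.toSchwartzMap h₂)

theorem memLp_waveSum_two (R : ℝ) (f : Lp ℂ 2 (volume : Measure ℝ)) :
    MemLp (waveSum 0 R f 0) 2 := (memLp_congr_ae (waveSum_ae_eq R f)).2 (Lp.memLp _)

theorem eLpNorm_waveSum_two_le (R : ℝ) (f : Lp ℂ 2 (volume : Measure ℝ)) :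
    eLpNorm (waveSum 0 R f 0) 2 ≤ ‖f‖ₑ := by
  rw [eLpNorm_congr_ae (waveSum_ae_eq R f), ← Lp.enorm_def, ← ofReal_norm, ← ofReal_norm]
  apply ENNReal.ofReal_le_ofReal
  have : ‖(𝓕⁻ (cutoff R f) : Lp ℂ 2 (volume : Measure ℝ))‖ = ‖cutoff R f‖ :=
    (Lp.fourierTransformₗᵢ ℝ ℂ).symm.norm_map _
  rw [this]
  exact norm_cutoff_le R f

/-- Pointwise `|u| ^ r ≤ M ^ (r - 2) |u| ^ 2`; this is all the interpolation required. Since `toReal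
∞ = 0` and `2 / 0 = 0`, the formula is also right at `r = ∞`. -/
theorem eLpNorm_le_bound_rpow_mul_eLpNorm_two_rpow {u : ℝ → ℂ} (hu : AEStronglyMeasurable u volume)
    {r : ℝ≥0∞} (hr : 2 ≤ r) {M : ℝ≥0∞} (hM : ∀ x, ‖u x‖ₑ ≤ M) :
    eLpNorm u r ≤ M ^ (1 - 2 / r.toReal) * eLpNorm u 2 ^ (2 / r.toReal) := by
  rcases eq_or_ne r ∞ with rfl | hr'
  · simp only [ENNReal.toReal_top, div_zero, sub_zero, ENNReal.rpow_one, ENNReal.rpow_zero, mul_one]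
    rw [eLpNorm_exponent_top]
    exact eLpNormEssSup_le_of_ae_enorm_bound (ae_of_all _ hM)
  have hρ : 2 ≤ r.toReal := by
    have := ENNReal.toReal_mono hr' hr
    simpa using this
  have h0 : r ≠ 0 := by rintro rfl; simp at hr
  rw [eLpNorm_eq_lintegral_rpow_enorm_toReal h0 hr',
    eLpNorm_eq_lintegral_rpow_enorm_toReal (by norm_num) (by norm_num)]
  simp only [ENNReal.toReal_ofNat]
  set ρ := r.toReal
  have h1 : ∫⁻ x, ‖u x‖ₑ ^ ρ ≤ M ^ (ρ - 2) * ∫⁻ x, ‖u x‖ₑ ^ (2 : ℝ) := by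
    rw [← lintegral_const_mul'' _ (by fun_prop)]
    apply lintegral_mono
    intro x
    calc ‖u x‖ₑ ^ ρ = ‖u x‖ₑ ^ (ρ - 2) * ‖u x‖ₑ ^ (2 : ℝ) := by
          rw [← ENNReal.rpow_add_of_nonneg _ _ (by linarith) (by norm_num)]; congr 1; ring
      _ ≤ _ := mul_le_mul_left (ENNReal.rpow_le_rpow (hM x) (by linarith)) _
  calc (∫⁻ x, ‖u x‖ₑ ^ ρ) ^ (1 / ρ) ≤ (M ^ (ρ - 2) * ∫⁻ x, ‖u x‖ₑ ^ (2 : ℝ)) ^ (1 / ρ) :=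
        ENNReal.rpow_le_rpow h1 (by positivity)
    _ = _ := by
        rw [ENNReal.mul_rpow_of_nonneg _ _ (by positivity), ← ENNReal.rpow_mul, ← ENNReal.rpow_mul]
        congr 2
        · field_simp
        · field_simp

theorem two_div_toReal_le_one {r : ℝ≥0∞} (hr : 2 ≤ r) : 2 / r.toReal ≤ 1 := by
  rcases eq_or_ne r ∞ with rfl | hr'
  · simp
  · have := ENNReal.toReal_mono hr' hr
    simp only [ENNReal.toReal_ofNat] at this
    rw [div_le_one (by linarith)]
    exact this

/-- A Bernstein inequality: Cauchy–Schwarz on `[-R, R]` bounds the supremum, and Plancherel the `L²`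
norm. The constant depends on `R`; it serves only to make `bandInv` a continuous operator. -/
theorem exists_eLpNorm_waveSum_le (R : ℝ) {r : ℝ≥0∞} (hr : 2 ≤ r) :
    ∃ C : ℝ≥0, ∀ f : Lp ℂ 2 (volume : Measure ℝ), eLpNorm (waveSum 0 R f 0) r ≤ C * ‖f‖ₑ := by
  set L : ℝ≥0 := (volume (Set.Icc (-R) R)).toNNReal ^ (1 / 2 : ℝ)
  refine ⟨L ^ (1 - 2 / r.toReal), fun f => ?_⟩
  have hθ : 0 ≤ 1 - 2 / r.toReal := sub_nonneg.2 (two_div_toReal_le_one hr)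
  have hM : ∀ x, ‖waveSum 0 R f 0 x‖ₑ ≤ L * ‖f‖ₑ := by
    intro x
    calc ‖waveSum 0 R f 0 x‖ₑ ≤ ∫⁻ ξ in Set.Icc (-R) R, ‖f ξ‖ₑ := by
          refine (enorm_integral_le_lintegral_enorm _).trans (le_of_eq ?_)
          simp only [enorm_mul, enorm_planeWave, one_mul]
      _ = eLpNorm f 1 (volume.restrict (Set.Icc (-R) R)) := eLpNorm_one_eq_lintegral_enorm.symm
      _ ≤ eLpNorm f 2 (volume.restrict (Set.Icc (-R) R)) *
            (volume.restrict (Set.Icc (-R) R)) Set.univ ^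
              (1 / (1 : ℝ≥0∞).toReal - 1 / (2 : ℝ≥0∞).toReal) :=
          eLpNorm_le_eLpNorm_mul_rpow_measure_univ (by norm_num)
            (Lp.aestronglyMeasurable f).restrict
      _ ≤ ‖f‖ₑ * L := by
          have hL : (L : ℝ≥0∞) = volume (Set.Icc (-R) R) ^ (1 / 2 : ℝ) := by
            simp only [L]
            rw [ENNReal.coe_rpow_of_nonneg _ (by norm_num), ENNReal.coe_toNNReal (by simp)]
          rw [hL, Lp.enorm_def]
          gcongr
          · exact Measure.restrict_le_self
          · rw [Measure.restrict_apply_univ]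
            norm_num
      _ = _ := mul_comm _ _
  refine (eLpNorm_le_bound_rpow_mul_eLpNorm_two_rpow
    (memLp_waveSum_two R f).aestronglyMeasurable hr hM).trans ?_
  calc _ ≤ (L * ‖f‖ₑ) ^ (1 - 2 / r.toReal) * ‖f‖ₑ ^ (2 / r.toReal) := by
        gcongr
        exact eLpNorm_waveSum_two_le R f
    _ = _ := by
        rw [ENNReal.mul_rpow_of_nonneg _ _ hθ, mul_assoc,
          ← ENNReal.rpow_add_of_nonneg _ _ hθ (by positivity), ENNReal.coe_rpow_of_nonneg _ hθ]
        simp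

theorem memLp_waveSum (R : ℝ) {r : ℝ≥0∞} (hr : 2 ≤ r) (f : Lp ℂ 2 (volume : Measure ℝ)) :
    MemLp (waveSum 0 R f 0) r := by
  obtain ⟨C, hC⟩ := exists_eLpNorm_waveSum_le R hr
  refine ⟨(memLp_waveSum_two R f).aestronglyMeasurable, (hC f).trans_lt ?_⟩
  exact ENNReal.mul_lt_top ENNReal.coe_lt_top (by simp)

/-- The inverse Fourier transform of the part of `f` with frequencies in `[-R, R]`, as a continuous
operator from `L²` to `L^r`. -/
noncomputable def bandInv (R : ℝ) (r : ℝ≥0∞) [Fact (1 ≤ r)] (hr : 2 ≤ r) :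
    Lp ℂ 2 (volume : Measure ℝ) →L[ℂ] Lp ℂ r (volume : Measure ℝ) :=
  LinearMap.mkContinuousOfExistsBound
    { toFun := fun f => (memLp_waveSum R hr f).toLp
      map_add' := fun f g => by
        rw [← MemLp.toLp_add]
        congr 1
        ext x
        rw [waveSum_congr _ _ (Lp.coeFn_add f g), Pi.add_apply]
        simp only [waveSum, Pi.add_apply, mul_add]
        refine integral_add ?_ ?_
        · exact (integrableOn_Lp_two R f).bdd_mul (c := 1)
            (measurable_planeWave continuous_const 0 x).aestronglyMeasurable
            (ae_of_all _ fun ξ => (norm_planeWave _ _ _ _).le)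
        · exact (integrableOn_Lp_two R g).bdd_mul (c := 1)
            (measurable_planeWave continuous_const 0 x).aestronglyMeasurable
            (ae_of_all _ fun ξ => (norm_planeWave _ _ _ _).le)
      map_smul' := fun c f => by
        rw [RingHom.id_apply, ← MemLp.toLp_const_smul]
        congr 1
        ext x
        rw [waveSum_congr _ _ (Lp.coeFn_smul c f), Pi.smul_apply]
        simp only [waveSum, Pi.smul_apply, smul_eq_mul, mul_left_comm]
        exact integral_const_mul _ _ }
    (by
      obtain ⟨C, hC⟩ := exists_eLpNorm_waveSum_le R hr
      refine ⟨C, fun f => ?_⟩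
      have h := hC f
      simp only [LinearMap.coe_mk, AddHom.coe_mk]
      rw [Lp.norm_toLp]
      have := ENNReal.toReal_mono (ENNReal.mul_ne_top ENNReal.coe_ne_top (by simp)) h
      simpa using this)

theorem coeFn_bandInv (R : ℝ) {r : ℝ≥0∞} [Fact (1 ≤ r)] (hr : 2 ≤ r)
    (f : Lp ℂ 2 (volume : Measure ℝ)) :
    bandInv R r hr f =ᵐ[volume] waveSum 0 R f 0 := (memLp_waveSum R hr f).coeFn_toLp

theorem toTemperedDistribution_bandInv (R : ℝ) {r : ℝ≥0∞} [Fact (1 ≤ r)] (hr : 2 ≤ r)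
    (f : Lp ℂ 2 (volume : Measure ℝ)) :
    (bandInv R r hr f : 𝓢'(ℝ, ℂ)) = (𝓕⁻ (cutoff R f) : Lp ℂ 2 (volume : Measure ℝ)) := by
  ext φ
  rw [Lp.toTemperedDistribution_apply, Lp.toTemperedDistribution_apply]
  apply integral_congr_ae
  filter_upwards [coeFn_bandInv R hr f, waveSum_ae_eq R f] with x h1 h2
  rw [h1, h2]

/-! ### Strichartz estimates for all admissible pairs -/

/-- Admissibility means `2 / r = 1 - 6 / μ`. Thus the `μ`-th power of the interpolated bound
contains exactly the sixth power controlled at the endpoint. -/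
theorem IsAdmissiblePair.exponent_eq {μ r : ℝ≥0∞} (h : IsAdmissiblePair μ r) (hμ : μ ≠ ∞) :
    (1 - 2 / r.toReal) * μ.toReal = 6 := by
  obtain ⟨h1, h2, h3⟩ := h
  have hμ2 : 2 ≤ μ.toReal := by simpa using ENNReal.toReal_mono hμ h1
  have hμ0 : μ ≠ 0 := by rintro rfl; simp at h1
  have hr0 : r ≠ 0 := by rintro rfl; simp at h2
  have h4 := congrArg ENNReal.toReal h3
  rw [ENNReal.toReal_add (ENNReal.div_ne_top (by norm_num) hμ0)
    (ENNReal.div_ne_top (by norm_num) hr0)] at h4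
  simp only [ENNReal.toReal_div, ENNReal.toReal_ofNat, ENNReal.toReal_one] at h4
  have h5 : 2 / r.toReal = 1 - 6 / μ.toReal := by
    have : 2 / r.toReal = 2 * (1 / r.toReal) := by ring
    rw [this]
    have : 6 / μ.toReal = 2 * (3 / μ.toReal) := by ring
    rw [this]
    linarith
  rw [h5]
  field_simp
  ring

theorem IsAdmissiblePair.eq_two {r : ℝ≥0∞} (h : IsAdmissiblePair ∞ r) : r = 2 := by
  have h3 := h.2.2
  simp only [ENNReal.div_top, zero_add, one_div] at h3
  exact inv_injective h3

theorem Lp_enorm_sq_eq_lintegral (f : Lp ℂ 2 (volume : Measure ℝ)) :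
    ∫⁻ ξ, ‖f ξ‖ₑ ^ 2 = ‖f‖ₑ ^ 2 := by
  rw [Lp.enorm_def, eLpNorm_eq_lintegral_rpow_enorm_toReal (by norm_num) (by norm_num)]
  simp only [ENNReal.toReal_ofNat]
  rw [← ENNReal.rpow_two, ← ENNReal.rpow_mul]
  simp

/-- The Strichartz estimates for frequency-localized data, uniformly in the localization. -/
theorem exists_eLpNorm_bandInv_evolve_le {P : ℝ → ℝ} (hP : Continuous P) {D : ℝ} (hD0 : 0 ≤ D)
    (hD : DispersiveBound P D) {μ r : ℝ≥0∞} [Fact (1 ≤ r)] (h : IsAdmissiblePair μ r) :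
    ∃ C : ℝ≥0, ∀ (n : ℕ) (T : ℝ) (f : Lp ℂ 2 (volume : Measure ℝ)),
      eLpNorm (fun t => bandInv n r h.2.1 (evolve P hP t f)) μ (volume.restrict (Set.Ioo 0 T)) ≤
        C * ‖f‖ₑ := by
  have hkey : ∀ (n : ℕ) (f : Lp ℂ 2 (volume : Measure ℝ)) (t : ℝ) (M : ℝ≥0∞),
      (∀ x, ‖waveSum P n f t x‖ₑ ≤ M) → ‖bandInv n r h.2.1 (evolve P hP t f)‖ₑ ≤
        M ^ (1 - 2 / r.toReal) * ‖f‖ₑ ^ (2 / r.toReal) := by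
    intro n f t M hM
    rw [Lp.enorm_def, eLpNorm_congr_ae (coeFn_bandInv _ _ _)]
    refine (eLpNorm_le_bound_rpow_mul_eLpNorm_two_rpow
      (memLp_waveSum_two _ _).aestronglyMeasurable h.2.1 (M := M) ?_).trans ?_
    · intro x
      rw [waveSum_evolve]
      exact hM x
    · gcongr
      refine (eLpNorm_waveSum_two_le _ _).trans ?_
      rw [← ofReal_norm, ← ofReal_norm]
      exact ENNReal.ofReal_le_ofReal (norm_evolve_le hP t f)
  set K : ℝ≥0 := 2 ^ (6 : ℝ) * (D.toNNReal * 10) ^ (3 : ℝ)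
  have hm : ∀ (n : ℕ) (f : Lp ℂ 2 (volume : Measure ℝ)), ∃ m : ℝ → ℝ≥0∞, Measurable m ∧
      (∀ t x, ‖waveSum P n f t x‖ₑ ≤ m t) ∧
      ∀ T, ∫⁻ t in Set.Ioo 0 T, m t ^ (6 : ℝ) ≤ K * ‖f‖ₑ ^ (6 : ℝ) := by
    intro n f
    obtain ⟨m, hm1, hm2, hm3⟩ := exists_measurable_bound_waveSum hP hD0 hD (Nat.cast_nonneg n)
      (integrableOn_Lp_two n f)
    refine ⟨m, hm1, hm2, fun T => ?_⟩
    calc ∫⁻ t in Set.Ioo 0 T, m t ^ (6 : ℝ) ≤ ∫⁻ t in Set.Icc (-T) T, m t ^ (6 : ℝ) :=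
          lintegral_mono_set fun t ht => ⟨by linarith [ht.1, ht.2], ht.2.le⟩
      _ ≤ _ := hm3 T
      _ ≤ 2 ^ (6 : ℝ) * ((ENNReal.ofReal D * 10) ^ (3 : ℝ) * (‖f‖ₑ ^ 2) ^ (3 : ℝ)) := by
          gcongr
          rw [← Lp_enorm_sq_eq_lintegral]
          exact setLIntegral_le_lintegral _ _
      _ = _ := by
          simp only [K]
          rw [← ENNReal.rpow_two, ← ENNReal.rpow_mul, ← mul_assoc, ENNReal.coe_mul,
            ENNReal.coe_rpow_of_nonneg _ (by norm_num), ENNReal.coe_rpow_of_nonneg _ (by norm_num)]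
          norm_num
          rfl
  -- For `μ = ∞` the pair forces `r = 2`, the power of `M` vanishes and only the `L²` bound remains.
  rcases eq_or_ne μ ∞ with rfl | hμ
  · refine ⟨1, fun n T f => ?_⟩
    obtain ⟨m, hm1, hm2, hm3⟩ := hm n f
    rw [eLpNorm_exponent_top]
    refine eLpNormEssSup_le_of_ae_enorm_bound (ae_of_all _ fun t => ?_)
    refine (hkey n f t (m t) (hm2 t)).trans ?_
    have hr2 := h.eq_two
    simp [hr2]
  · have hexp := h.exponent_eq hμ
    have hμ2 : 2 ≤ μ.toReal := by simpa using ENNReal.toReal_mono hμ h.1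
    have hμ0 : μ ≠ 0 := by rintro rfl; simpa using h.1
    refine ⟨K ^ (1 / μ.toReal), fun n T f => ?_⟩
    obtain ⟨m, hm1, hm2, hm3⟩ := hm n f
    have hθ : 0 ≤ 2 / r.toReal := by positivity
    rw [eLpNorm_eq_lintegral_rpow_enorm_toReal hμ0 hμ]
    -- The powers of `‖f‖` add up to `6 + (2 / r) μ = μ`.
    have hint : ∫⁻ t in Set.Ioo 0 T, ‖bandInv n r h.2.1 (evolve P hP t f)‖ₑ ^ μ.toReal ≤
        K * ‖f‖ₑ ^ μ.toReal := by
      calc _ ≤ ∫⁻ t in Set.Ioo 0 T, m t ^ (6 : ℝ) * ‖f‖ₑ ^ (2 / r.toReal * μ.toReal) := by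
            apply lintegral_mono
            intro t
            refine (ENNReal.rpow_le_rpow (hkey n f t (m t) (hm2 t))
              ENNReal.toReal_nonneg).trans (le_of_eq ?_)
            rw [ENNReal.mul_rpow_of_nonneg _ _ ENNReal.toReal_nonneg, ← ENNReal.rpow_mul,
              ← ENNReal.rpow_mul, hexp]
        _ = (∫⁻ t in Set.Ioo 0 T, m t ^ (6 : ℝ)) * ‖f‖ₑ ^ (2 / r.toReal * μ.toReal) :=
            lintegral_mul_const _ (by fun_prop)
        _ ≤ K * ‖f‖ₑ ^ (6 : ℝ) * ‖f‖ₑ ^ (2 / r.toReal * μ.toReal) := by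
            gcongr; exact hm3 T
        _ = _ := by
            rw [mul_assoc, ← ENNReal.rpow_add_of_nonneg _ _ (by norm_num) (by positivity)]
            congr 2
            linarith
    calc _ ≤ (K * ‖f‖ₑ ^ μ.toReal) ^ (1 / μ.toReal) :=
          ENNReal.rpow_le_rpow hint (by positivity)
      _ = _ := by
          rw [ENNReal.mul_rpow_of_nonneg _ _ (by positivity), ← ENNReal.rpow_mul,
            ENNReal.coe_rpow_of_nonneg _ (by positivity), mul_one_div_cancel (by positivity),
            ENNReal.rpow_one]

/-- Evolution and cut-off are both multiplications in frequency, and the narrower band prevails. Two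
truncations can thus be written with one band operator, so that the uniform estimate applies to
their difference. -/
theorem bandInv_evolve_cutoff {P : ℝ → ℝ} (hP : Continuous P) {r : ℝ≥0∞} [Fact (1 ≤ r)]
    (hr : 2 ≤ r) {n k : ℕ} (hnk : n ≤ k) (t : ℝ) (f : Lp ℂ 2 (volume : Measure ℝ)) :
    bandInv k r hr (evolve P hP t (cutoff n f)) = bandInv n r hr (evolve P hP t f) := by
  apply Lp.ext
  filter_upwards [coeFn_bandInv k hr (evolve P hP t (cutoff n f)),
    coeFn_bandInv n hr (evolve P hP t f)] with x h1 h2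
  rw [h1, h2, waveSum_evolve, waveSum_evolve, waveSum_congr P _ (coeFn_cutoff n f)]
  have hsub : Set.Icc (-(n : ℝ)) n ⊆ Set.Icc (-(k : ℝ)) k := by
    have : (n : ℝ) ≤ k := by exact_mod_cast hnk
    exact Set.Icc_subset_Icc (by linarith) this
  have h3 : ∀ ξ, planeWave P t x ξ * (Set.Icc (-(n : ℝ)) n).indicator f ξ =
      (Set.Icc (-(n : ℝ)) n).indicator (fun ξ => planeWave P t x ξ * f ξ) ξ := fun ξ => by
    by_cases hξ : ξ ∈ Set.Icc (-(n : ℝ)) n <;> simp [hξ]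
  simp only [waveSum, h3]
  rw [setIntegral_indicator measurableSet_Icc, Set.inter_eq_right.2 hsub]

/-- The Strichartz estimates for the group on `L²`. -/
theorem exists_strichartz {P : ℝ → ℝ} (hP : Continuous P) {D : ℝ} (hD0 : 0 ≤ D)
    (hD : DispersiveBound P D) {μ r : ℝ≥0∞} [Fact (1 ≤ r)] (h : IsAdmissiblePair μ r) :
    ∃ C : ℝ≥0, ∀ (T : ℝ) (f : Lp ℂ 2 (volume : Measure ℝ)),
      ∃ G : ℝ → Lp ℂ r (volume : Measure ℝ), MemLp G μ (volume.restrict (Set.Ioo 0 T)) ∧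
        eLpNorm G μ (volume.restrict (Set.Ioo 0 T)) ≤ C * ‖f‖ₑ ∧
        ∀ᵐ t ∂(volume.restrict (Set.Ioo 0 T)), (G t : 𝓢'(ℝ, ℂ)) =
          ((𝓕⁻ (evolve P hP t f) : Lp ℂ 2 (volume : Measure ℝ)) : 𝓢'(ℝ, ℂ)) := by
  obtain ⟨C, hC⟩ := exists_eLpNorm_bandInv_evolve_le hP hD0 hD h
  refine ⟨C, fun T f => ?_⟩
  have : Fact (1 ≤ μ) := ⟨le_trans (by norm_num) h.1⟩
  have hμ0 : μ ≠ 0 := by rintro rfl; simpa using h.1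
  set F : ℕ → ℝ → Lp ℂ r (volume : Measure ℝ) := fun n t => bandInv n r h.2.1 (evolve P hP t f)
  have hmem : ∀ n, MemLp (F n) μ (volume.restrict (Set.Ioo 0 T)) := fun n =>
    ⟨((bandInv n r h.2.1).continuous.comp (continuous_evolve hP f)).aestronglyMeasurable,
      (hC n T f).trans_lt (ENNReal.mul_lt_top ENNReal.coe_lt_top (by simp))⟩
  set L : ℕ → Lp (Lp ℂ r (volume : Measure ℝ)) μ (volume.restrict (Set.Ioo 0 T)) :=
    fun n => (hmem n).toLp
  have hdist : ∀ n m, edist (L n) (L m) ≤ C * edist (cutoff n f) (cutoff m f) := by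
    intro n m
    rw [Lp.edist_toLp_toLp, edist_eq_enorm_sub (cutoff n f)]
    refine le_trans (le_of_eq ?_) (hC (max n m) T (cutoff n f - cutoff m f))
    congr 1
    ext1 t
    rw [map_sub, map_sub, bandInv_evolve_cutoff hP h.2.1 (le_max_left n m),
      bandInv_evolve_cutoff hP h.2.1 (le_max_right n m)]
    rfl
  have hcauchy : CauchySeq L := by
    have hc := (tendsto_cutoff f).cauchySeq
    rw [EMetric.cauchySeq_iff] at hc ⊢
    intro ε hε
    -- Dividing by `C + 1` avoids the case `C = 0`.
    obtain ⟨N, hN⟩ := hc (ε / (C + 1)) (ENNReal.div_pos hε.ne' (by simp))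
    refine ⟨N, fun m hm n hn => ?_⟩
    calc edist (L m) (L n) ≤ C * edist (cutoff m f) (cutoff n f) := hdist m n
      _ ≤ (C + 1) * edist (cutoff m f) (cutoff n f) := by gcongr; exact le_self_add
      _ < ε := by
          have := hN m hm n hn
          rw [ENNReal.lt_div_iff_mul_lt (by simp) (by simp)] at this
          rwa [mul_comm]
  obtain ⟨G, hG⟩ := cauchySeq_tendsto_of_complete hcauchy
  refine ⟨G, Lp.memLp G, ?_, ?_⟩
  · rw [← Lp.enorm_def]
    refine le_of_tendsto hG.enorm (Eventually.of_forall fun n => ?_)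
    rw [Lp.enorm_toLp]
    exact hC n T f
  -- Along a subsequence the truncations converge in `L^r` for almost every `t`, and they also
  -- converge in `L²`. Both spaces embed continuously in tempered distributions, so the two limits
  -- agree.
  · have hmeas := tendstoInMeasure_of_tendsto_Lp hG
    obtain ⟨ns, hns, hlim⟩ := hmeas.exists_seq_tendsto_ae
    have hL : ∀ᵐ t ∂(volume.restrict (Set.Ioo 0 T)), ∀ n, L n t = F n t :=
      ae_all_iff.2 fun n => (hmem n).coeFn_toLp
    filter_upwards [hlim, hL] with t ht hLt
    simp only [hLt] at ht
    have h1 := ((Lp.toTemperedDistributionCLM ℂ volume r).continuous.tendsto _).comp ht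
    have h2 := ((Lp.toTemperedDistributionCLM ℂ volume 2).continuous.tendsto _).comp
      (((Lp.fourierTransformₗᵢ ℝ ℂ).symm.continuous.tendsto _).comp
        ((tendsto_cutoff (evolve P hP t f)).comp hns.tendsto_atTop))
    refine tendsto_nhds_unique h1 (h2.congr fun n => ?_)
    exact (toTemperedDistribution_bandInv (ns n) h.2.1 (evolve P hP t f)).symm

/-! ### The group on tempered distributions: existence and uniqueness -/

theorem hasTemperateGrowth_cexp_I_mul :
    (fun x : ℝ => Complex.exp (Complex.I * x)).HasTemperateGrowth := by
  have hd : ∀ n : ℕ, iteratedDeriv n (fun x : ℝ => Complex.exp (Complex.I * x)) =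
      fun x : ℝ => Complex.I ^ n * Complex.exp (Complex.I * x) := by
    intro n
    induction n with
    | zero => simp
    | succ n ih =>
      rw [iteratedDeriv_succ, ih]
      ext x
      have : HasDerivAt (fun x : ℝ => Complex.I ^ n * Complex.exp (Complex.I * x))
          (Complex.I ^ n * (Complex.exp (Complex.I * x) * (Complex.I * 1))) x :=
        (((hasDerivAt_id x).ofReal_comp.const_mul Complex.I).cexp).const_mul _
      rw [this.deriv]
      ring
  refine ⟨Complex.contDiff_exp.comp (contDiff_const.mul Complex.ofRealCLM.contDiff),
    fun n => ⟨0, 1, fun x => ?_⟩⟩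
  rw [norm_iteratedFDeriv_eq_norm_iteratedDeriv, hd, norm_mul, norm_pow, Complex.norm_I,
    mul_comm Complex.I, Complex.norm_exp_ofReal_mul_I]
  simp

theorem hasTemperateGrowth_planeWave {P : ℝ → ℝ} (hP : P.HasTemperateGrowth) (t : ℝ) :
    (planeWave P t 0).HasTemperateGrowth := by
  have h1 : (fun ξ : ℝ => t * P ξ).HasTemperateGrowth := by fun_prop
  have h := hasTemperateGrowth_cexp_I_mul.comp h1
  convert h using 1
  ext ξ
  simp [planeWave]

theorem planeWave_add (P : ℝ → ℝ) (t t' ξ : ℝ) :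
    planeWave P t 0 ξ * planeWave P t' 0 ξ = planeWave P (t + t') 0 ξ := by
  unfold planeWave
  rw [← Complex.exp_add]
  congr 1
  push_cast
  ring

theorem planeWave_zero (P : ℝ → ℝ) (ξ : ℝ) : planeWave P 0 0 ξ = 1 := by
  simp [planeWave]

theorem hasDerivAt_planeWave (P : ℝ → ℝ) (t ξ : ℝ) :
    HasDerivAt (fun τ => planeWave P τ 0 ξ) (Complex.I * P ξ * planeWave P t 0 ξ) t := by
  have h1 : HasDerivAt (fun τ : ℝ => 2 * Real.pi * 0 * ξ + τ * P ξ) (P ξ) t := by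
    simpa using ((hasDerivAt_id t).mul_const (P ξ)).const_add (2 * Real.pi * 0 * ξ)
  exact ((h1.ofReal_comp.const_mul Complex.I).cexp).congr_deriv (by unfold planeWave; ring)

theorem norm_planeWave_sub_le (P : ℝ → ℝ) (t t' ξ : ℝ) :
    ‖planeWave P t 0 ξ - planeWave P t' 0 ξ‖ ≤ |P ξ| * |t - t'| := by
  have := Convex.norm_image_sub_le_of_norm_hasDerivWithin_le (s := Set.univ) (C := |P ξ|)
    (f := fun τ => planeWave P τ 0 ξ) (fun τ _ => (hasDerivAt_planeWave P τ ξ).hasDerivWithinAt)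
    (fun τ _ => by simp [norm_planeWave]) convex_univ (Set.mem_univ t') (Set.mem_univ t)
  simpa using this

theorem Function.HasTemperateGrowth.continuous {E F : Type*} [NormedAddCommGroup E]
    [NormedSpace ℝ E] [NormedAddCommGroup F] [NormedSpace ℝ F] {f : E → F}
    (h : f.HasTemperateGrowth) : Continuous f := h.1.continuous

theorem evolve_toLp {P : ℝ → ℝ} (hP : P.HasTemperateGrowth) (t : ℝ) (ψ : 𝓢(ℝ, ℂ)) :
    evolve P hP.continuous t (ψ.toLp 2) =
      (SchwartzMap.smulLeftCLM ℂ (planeWave P t 0) ψ).toLp 2 := by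
  apply Lp.ext
  filter_upwards [coeFn_evolve hP.continuous t (ψ.toLp 2), ψ.coeFn_toLp 2 volume,
    (SchwartzMap.smulLeftCLM ℂ (planeWave P t 0) ψ).coeFn_toLp 2 volume] with ξ h1 h2 h3
  rw [h1, h2, h3, SchwartzMap.smulLeftCLM_apply_apply (hasTemperateGrowth_planeWave hP t),
    smul_eq_mul]

/-- The symbol of the time derivative of the group. -/
noncomputable def genSymbol (P : ℝ → ℝ) (ξ : ℝ) : ℂ := Complex.I * P ξ

theorem hasTemperateGrowth_genSymbol {P : ℝ → ℝ} (hP : P.HasTemperateGrowth) :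
    (genSymbol P).HasTemperateGrowth := by
  have : (fun ξ => ((P ξ : ℝ) : ℂ)).HasTemperateGrowth := (show Complex.ofReal.HasTemperateGrowth by fun_prop).comp hP
  unfold genSymbol
  fun_prop

/-- On Schwartz functions the group is differentiable in `L²`. -/
theorem hasDerivAt_evolve_toLp {P : ℝ → ℝ} (hP : P.HasTemperateGrowth) (t : ℝ) (ψ : 𝓢(ℝ, ℂ)) :
    HasDerivAt (fun τ => evolve P hP.continuous τ (ψ.toLp 2))
      ((SchwartzMap.smulLeftCLM ℂ (genSymbol P)
        (SchwartzMap.smulLeftCLM ℂ (planeWave P t 0) ψ)).toLp 2) t := by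
  have hPc := hP.continuous
  -- The symbol `P` may be unbounded, so the weight `W` is moved onto the Schwartz function. The
  -- difference quotients divided by `W` are bounded by `|P| / (1 + P ^ 2) ≤ 1`, as `tendsto_mulL2`
  -- requires; `1 + P ^ 2` retains temperate growth.
  set W : ℝ → ℂ := fun ξ => ((1 + P ξ ^ 2 : ℝ) : ℂ)
  have hW : W.HasTemperateGrowth := by
    have : (fun ξ => 1 + P ξ ^ 2).HasTemperateGrowth := by fun_prop
    exact (show Complex.ofReal.HasTemperateGrowth by fun_prop).comp this
  have hWpos : ∀ ξ, 0 < 1 + P ξ ^ 2 := fun ξ => by positivity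
  have hWne : ∀ ξ, W ξ ≠ 0 := fun ξ => by
    simp only [W]; exact_mod_cast (hWpos ξ).ne'
  have hWn : ∀ ξ, ‖(W ξ)⁻¹‖ = (1 + P ξ ^ 2)⁻¹ := fun ξ => by
    rw [norm_inv]
    simp only [W]
    rw [Complex.norm_real, Real.norm_of_nonneg (hWpos ξ).le]
  have hPW : ∀ ξ, |P ξ| * (1 + P ξ ^ 2)⁻¹ ≤ 1 := fun ξ => by
    rw [mul_inv_le_iff₀ (hWpos ξ), one_mul]
    nlinarith [sq_abs (P ξ), sq_nonneg (|P ξ| - 1)]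
  have hWc : Continuous W := hW.continuous
  set m : ℝ → ℝ → ℂ := fun τ ξ =>
    ((τ - t : ℝ) : ℂ)⁻¹ * (planeWave P τ 0 ξ - planeWave P t 0 ξ) * (W ξ)⁻¹
  have hm : ∀ τ, Measurable (m τ) := fun τ =>
    (((measurable_planeWave hPc τ 0).sub (measurable_planeWave hPc t 0)).const_mul _).mul
      hWc.measurable.inv
  have hb : ∀ τ ξ, ‖m τ ξ‖ ≤ 1 := by
    intro τ ξ
    simp only [m]
    rw [norm_mul, norm_mul, hWn, norm_inv, Complex.norm_real, Real.norm_eq_abs]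
    rcases eq_or_ne τ t with rfl | hτ
    · simp
    have h0 : 0 < |τ - t| := abs_pos.2 (sub_ne_zero.2 hτ)
    calc _ ≤ |τ - t|⁻¹ * (|P ξ| * |τ - t|) * (1 + P ξ ^ 2)⁻¹ := by
          have := (hWpos ξ).le
          gcongr
          exact norm_planeWave_sub_le P τ t ξ
      _ = |P ξ| * (1 + P ξ ^ 2)⁻¹ := by field_simp
      _ ≤ 1 := hPW ξ
  set m₀ : ℝ → ℂ := fun ξ => Complex.I * P ξ * planeWave P t 0 ξ * (W ξ)⁻¹
  have hm₀ : Measurable m₀ := by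
    have := measurable_planeWave hPc t 0
    have := hWc.measurable
    have := hPc.measurable
    fun_prop
  have hb₀ : ∀ ξ, ‖m₀ ξ‖ ≤ 1 := fun ξ => by
    simp only [m₀]
    rw [norm_mul, norm_mul, norm_mul, hWn, norm_planeWave, Complex.norm_I, Complex.norm_real,
      one_mul, mul_one]
    exact hPW ξ
  set A := (SchwartzMap.smulLeftCLM ℂ W ψ).toLp 2
  have hlim : Tendsto (fun τ => mulL2 (m τ) (hm τ) (hb τ) A) (𝓝[≠] t)
      (𝓝 (mulL2 m₀ hm₀ hb₀ A)) := by
    refine tendsto_mulL2 hm hb hm₀ hb₀ (fun ξ => ?_) A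
    have := (hasDerivAt_iff_tendsto_slope.1 (hasDerivAt_planeWave P t ξ)).mul_const (W ξ)⁻¹
    refine this.congr fun τ => ?_
    simp only [m, slope_def_module, Complex.real_smul]
    push_cast
    ring
  have hAe : A =ᵐ[volume] fun ξ => W ξ * ψ ξ := by
    filter_upwards [(SchwartzMap.smulLeftCLM ℂ W ψ).coeFn_toLp 2 volume] with ξ h
    rw [h, SchwartzMap.smulLeftCLM_apply_apply hW, smul_eq_mul]
  have h0 : mulL2 m₀ hm₀ hb₀ A = (SchwartzMap.smulLeftCLM ℂ (genSymbol P)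
        (SchwartzMap.smulLeftCLM ℂ (planeWave P t 0) ψ)).toLp 2 := by
    apply Lp.ext
    filter_upwards [coeFn_mulL2 hm₀ hb₀ A, hAe, (SchwartzMap.smulLeftCLM ℂ (genSymbol P)
        (SchwartzMap.smulLeftCLM ℂ (planeWave P t 0) ψ)).coeFn_toLp 2 volume] with ξ h1 h2 h3
    rw [h1, h2, h3, SchwartzMap.smulLeftCLM_apply_apply (hasTemperateGrowth_genSymbol hP),
      SchwartzMap.smulLeftCLM_apply_apply (hasTemperateGrowth_planeWave hP t), genSymbol]
    have := hWne ξ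
    simp only [m₀, smul_eq_mul]
    field_simp
  rw [hasDerivAt_iff_tendsto_slope, ← h0]
  refine hlim.congr fun τ => ?_
  rw [slope_def_module]
  apply Lp.ext
  filter_upwards [coeFn_mulL2 (hm τ) (hb τ) A, hAe, coeFn_evolve hPc τ (ψ.toLp 2),
    coeFn_evolve hPc t (ψ.toLp 2), ψ.coeFn_toLp 2 volume,
    Lp.coeFn_smul (τ - t)⁻¹ (evolve P hPc τ (ψ.toLp 2) - evolve P hPc t (ψ.toLp 2)),
    Lp.coeFn_sub (evolve P hPc τ (ψ.toLp 2)) (evolve P hPc t (ψ.toLp 2))]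
    with ξ h1 h2 h3 h4 h5 h6 h7
  rw [h1, h2, h6, Pi.smul_apply, h7, Pi.sub_apply, h3, h4, h5, Complex.real_smul]
  have := hWne ξ
  simp only [m]
  push_cast
  field_simp

/-- The bilinear pairing of `L²` with itself. -/
noncomputable def pairL2 : Lp ℂ 2 (volume : Measure ℝ) →L[ℂ] Lp ℂ 2 (volume : Measure ℝ) →L[ℂ] ℂ :=
  (ContinuousLinearMap.mul ℂ ℂ).lpPairing volume 2 2

theorem pairL2_toLp (ψ : 𝓢(ℝ, ℂ)) (g : Lp ℂ 2 (volume : Measure ℝ)) :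
    pairL2 (ψ.toLp 2) g = (g : 𝓢'(ℝ, ℂ)) ψ := by
  rw [pairL2, ContinuousLinearMap.lpPairing_eq_integral, Lp.toTemperedDistribution_apply]
  apply integral_congr_ae
  filter_upwards [ψ.coeFn_toLp 2 volume] with ξ h
  rw [h]
  rfl

theorem besselSymbol_mul_neg (s : ℝ) : besselSymbol s * besselSymbol (-s) = 1 := by
  ext ξ
  simp only [Pi.mul_apply, besselSymbol, Pi.one_apply]
  rw [← Complex.ofReal_mul, ← Real.rpow_add (by positivity), neg_div, add_neg_cancel,
    Real.rpow_zero, Complex.ofReal_one]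

theorem smulLeft_besselSymbol_neg (s : ℝ) (ψ : 𝓢(ℝ, ℂ)) :
    SchwartzMap.smulLeftCLM ℂ (besselSymbol s) (SchwartzMap.smulLeftCLM ℂ (besselSymbol (-s)) ψ) =
      ψ := by
  rw [SchwartzMap.smulLeftCLM_smulLeftCLM_apply (besselSymbol_hasTemperateGrowth s)
    (besselSymbol_hasTemperateGrowth (-s)), besselSymbol_mul_neg]
  have := SchwartzMap.smulLeftCLM_const (𝕜 := ℂ) (E := ℝ) (F := ℂ) (1 : ℂ)
  have h1 : (1 : ℝ → ℂ) = fun _ => 1 := rfl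
  rw [h1, this]
  simp

/-- The Fourier transform of an element of `H^s`, tested against a Schwartz function. -/
theorem fourier_apply_of_besselOp {s : ℝ} {u : 𝓢'(ℝ, ℂ)} {F : Lp ℂ 2 (volume : Measure ℝ)}
    (h : besselOp s u = (F : 𝓢'(ℝ, ℂ))) (ψ : 𝓢(ℝ, ℂ)) :
    (𝓕 u : 𝓢'(ℝ, ℂ)) ψ =
      pairL2 ((SchwartzMap.smulLeftCLM ℂ (besselSymbol (-s)) ψ).toLp 2) (𝓕 F) := by
  rw [pairL2_toLp, ← Lp.fourier_toTemperedDistribution_eq, ← h, besselOp,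
    TemperedDistribution.fourierMultiplierCLM_apply, fourier_fourierInv_eq,
    TemperedDistribution.smulLeftCLM_apply_apply, smulLeft_besselSymbol_neg]

theorem smulLeft_comm {g₁ g₂ : ℝ → ℂ} (h₁ : g₁.HasTemperateGrowth) (h₂ : g₂.HasTemperateGrowth)
    (ψ : 𝓢(ℝ, ℂ)) : SchwartzMap.smulLeftCLM ℂ g₁ (SchwartzMap.smulLeftCLM ℂ g₂ ψ) =
      SchwartzMap.smulLeftCLM ℂ g₂ (SchwartzMap.smulLeftCLM ℂ g₁ ψ) := by
  rw [SchwartzMap.smulLeftCLM_smulLeftCLM_apply h₁ h₂,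
    SchwartzMap.smulLeftCLM_smulLeftCLM_apply h₂ h₁, mul_comm]

/-- The solution operator. -/
noncomputable def solution (P : ℝ → ℝ) (t : ℝ) : 𝓢'(ℝ, ℂ) →L[ℂ] 𝓢'(ℝ, ℂ) :=
  TemperedDistribution.fourierMultiplierCLM ℂ (planeWave P t 0)

theorem solution_toTemperedDistribution {P : ℝ → ℝ} (hP : P.HasTemperateGrowth) (t : ℝ)
    (g : Lp ℂ 2 (volume : Measure ℝ)) :
    solution P t (g : 𝓢'(ℝ, ℂ)) =
      ((𝓕⁻ (evolve P hP.continuous t (𝓕 g)) : Lp ℂ 2 (volume : Measure ℝ)) : 𝓢'(ℝ, ℂ)) := by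
  rw [solution, TemperedDistribution.fourierMultiplierCLM_apply,
    Lp.fourier_toTemperedDistribution_eq, ← Lp.fourierInv_toTemperedDistribution_eq]
  congr 1
  ext φ
  rw [TemperedDistribution.smulLeftCLM_apply_apply, Lp.toTemperedDistribution_apply,
    Lp.toTemperedDistribution_apply]
  apply integral_congr_ae
  filter_upwards [coeFn_evolve hP.continuous t (𝓕 g)] with ξ h
  rw [h, SchwartzMap.smulLeftCLM_apply_apply (hasTemperateGrowth_planeWave hP t)]
  simp only [smul_eq_mul]
  ring

/-- Fourier multipliers commute; this is what reduces regularity `s` to the `L²` case. -/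
theorem besselOp_solution {P : ℝ → ℝ} (hP : P.HasTemperateGrowth) (s t : ℝ) (u : 𝓢'(ℝ, ℂ)) :
    besselOp s (solution P t u) = solution P t (besselOp s u) := by
  rw [besselOp, solution, TemperedDistribution.fourierMultiplierCLM_fourierMultiplierCLM_apply
      (hasTemperateGrowth_planeWave hP t) (besselSymbol_hasTemperateGrowth s),
    TemperedDistribution.fourierMultiplierCLM_fourierMultiplierCLM_apply
      (besselSymbol_hasTemperateGrowth s) (hasTemperateGrowth_planeWave hP t), mul_comm]

theorem besselOp_solution_eq {P : ℝ → ℝ} (hP : P.HasTemperateGrowth) {s : ℝ} {u : 𝓢'(ℝ, ℂ)}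
    {g : Lp ℂ 2 (volume : Measure ℝ)} (h : besselOp s u = (g : 𝓢'(ℝ, ℂ))) (t : ℝ) :
    besselOp s (solution P t u) =
      ((𝓕⁻ (evolve P hP.continuous t (𝓕 g)) : Lp ℂ 2 (volume : Measure ℝ)) : 𝓢'(ℝ, ℂ)) := by
  rw [besselOp_solution hP, h, solution_toTemperedDistribution hP]

theorem solution_apply (P : ℝ → ℝ) (t : ℝ) (u : 𝓢'(ℝ, ℂ)) (φ : 𝓢(ℝ, ℂ)) :
    solution P t u φ =
      (𝓕 u : 𝓢'(ℝ, ℂ)) (SchwartzMap.smulLeftCLM ℂ (planeWave P t 0) (𝓕⁻ φ)) := rfl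

theorem continuousInSobolev_solution {P : ℝ → ℝ} (hP : P.HasTemperateGrowth) {s : ℝ}
    {u : 𝓢'(ℝ, ℂ)} (h : MemBessel s 2 u) : ContinuousInSobolev s fun t => solution P t u := by
  obtain ⟨g, hg⟩ := h
  exact ⟨fun t => 𝓕⁻ (evolve P hP.continuous t (𝓕 g)),
    (Lp.fourierTransformₗᵢ ℝ ℂ).symm.continuous.comp (continuous_evolve hP.continuous (𝓕 g)),
    fun t => besselOp_solution_eq hP hg t⟩

/-- The generator of the group, as an operator on tempered distributions. -/
noncomputable def generator (P : ℝ → ℝ) : 𝓢'(ℝ, ℂ) →L[ℂ] 𝓢'(ℝ, ℂ) :=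
  TemperedDistribution.fourierMultiplierCLM ℂ (genSymbol P)

theorem generator_apply_fourier (P : ℝ → ℝ) (u : 𝓢'(ℝ, ℂ)) (ψ : 𝓢(ℝ, ℂ)) :
    generator P u (𝓕 ψ) = (𝓕 u : 𝓢'(ℝ, ℂ)) (SchwartzMap.smulLeftCLM ℂ (genSymbol P) ψ) := by
  rw [generator, TemperedDistribution.fourierMultiplierCLM_apply_apply, fourierInv_fourier_eq]
  rfl

/-- The value on `φ` is an `L²` pairing in which the propagator acts on the Schwartz factor only.
Strong differentiability there suffices, whatever the regularity of the datum. -/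
theorem hasDerivAt_solution_apply {P : ℝ → ℝ} (hP : P.HasTemperateGrowth) {s : ℝ}
    {u : 𝓢'(ℝ, ℂ)} (h : MemBessel s 2 u) (t : ℝ) (φ : 𝓢(ℝ, ℂ)) :
    HasDerivAt (fun τ => solution P τ u φ) (generator P (solution P t u) φ) t := by
  obtain ⟨g, hg⟩ := h
  have hw := besselSymbol_hasTemperateGrowth (-s)
  set ψ : 𝓢(ℝ, ℂ) := 𝓕⁻ φ
  have hφ : φ = 𝓕 ψ := (fourier_fourierInv_eq φ).symm
  have h1 : ∀ τ, solution P τ u φ = pairL2 (evolve P hP.continuous τ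
      ((SchwartzMap.smulLeftCLM ℂ (besselSymbol (-s)) ψ).toLp 2)) (𝓕 g) := by
    intro τ
    rw [solution_apply, fourier_apply_of_besselOp hg, evolve_toLp hP,
      smulLeft_comm hw (hasTemperateGrowth_planeWave hP τ)]
  simp_rw [h1]
  have h2 : generator P (solution P t u) φ = pairL2 ((SchwartzMap.smulLeftCLM ℂ (genSymbol P)
        (SchwartzMap.smulLeftCLM ℂ (planeWave P t 0)
          (SchwartzMap.smulLeftCLM ℂ (besselSymbol (-s)) ψ))).toLp 2) (𝓕 g) := by
    rw [hφ, generator_apply_fourier]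
    have h3 : ∀ χ : 𝓢(ℝ, ℂ), (𝓕 (solution P t u) : 𝓢'(ℝ, ℂ)) χ =
        (𝓕 u : 𝓢'(ℝ, ℂ)) (SchwartzMap.smulLeftCLM ℂ (planeWave P t 0) χ) := fun χ => by
      rw [TemperedDistribution.fourier_apply, solution_apply, fourierInv_fourier_eq]
    rw [h3, fourier_apply_of_besselOp hg,
      smulLeft_comm (hasTemperateGrowth_planeWave hP t) (hasTemperateGrowth_genSymbol hP),
      smulLeft_comm hw (hasTemperateGrowth_genSymbol hP),
      smulLeft_comm hw (hasTemperateGrowth_planeWave hP t)]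
  rw [h2]
  exact ((pairL2.flip (𝓕 g)).restrictScalars ℝ).hasFDerivAt.comp_hasDerivAt t
    (hasDerivAt_evolve_toLp hP t _)

/-- The product rule for a bilinear map, where the second factor is only differentiable after
pairing with the value of the first. -/
theorem hasDerivAt_bilinear_of_hasDerivAt_pairing {E G : Type*} [NormedAddCommGroup E]
    [NormedSpace ℂ E] [NormedAddCommGroup G] [NormedSpace ℂ G] (B : E →L[ℂ] G →L[ℂ] ℂ)
    {a : ℝ → E} {f : ℝ → G} {a' : E} {c : ℂ} {τ : ℝ} (ha : HasDerivAt a a' τ)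
    (hf : ContinuousAt f τ) (hw : HasDerivAt (fun σ => B (a τ) (f σ)) c τ) :
    HasDerivAt (fun σ => B (a σ) (f σ)) (B a' (f τ) + c) τ := by
  rw [hasDerivAt_iff_tendsto_slope] at ha hw ⊢
  have hcont : Tendsto f (𝓝[≠] τ) (𝓝 (f τ)) := hf.tendsto.mono_left nhdsWithin_le_nhds
  have h1 : Tendsto (fun σ => B (slope a τ σ) (f σ)) (𝓝[≠] τ) (𝓝 (B a' (f τ))) :=
    (B.continuous₂.tendsto (a', f τ)).comp (ha.prodMk_nhds hcont)
  -- Discrete Leibniz rule: `B(a σ, f σ) - B(a τ, f τ) = B(a σ - a τ, f σ) + B(a τ, f σ - f τ)`.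
  refine (h1.add hw).congr fun σ => ?_
  simp only [slope_def_module]
  rw [← Complex.coe_smul, map_smul, smul_apply, map_sub, sub_apply, ← Complex.coe_smul,
    ← Complex.coe_smul, ← smul_add]
  congr 1
  ring

/-- Uniqueness for the evolution equation in `C(ℝ; H^s)`. -/
theorem eq_solution_of_hasDerivAt {P : ℝ → ℝ} (hP : P.HasTemperateGrowth) {s : ℝ}
    {y : ℝ → 𝓢'(ℝ, ℂ)} (hc : ContinuousInSobolev s y)
    (hy : ∀ (t : ℝ) (φ : 𝓢(ℝ, ℂ)), HasDerivAt (fun τ => y τ φ) (generator P (y t) φ) t) (t : ℝ) :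
    y t = solution P t (y 0) := by
  obtain ⟨F, hF, hyF⟩ := hc
  have hw := besselSymbol_hasTemperateGrowth (-s)
  have hg := hasTemperateGrowth_genSymbol hP
  have hpw := hasTemperateGrowth_planeWave hP
  have hFc : Continuous fun τ => (𝓕 (F τ) : Lp ℂ 2 (volume : Measure ℝ)) :=
    (Lp.fourierTransformₗᵢ ℝ ℂ).continuous.comp hF
  -- A conservation law: testing against the backward-evolved `ψ` gives a constant in `τ`. The test
  -- side is differentiable in `L²`, the solution side only weakly, and the two derivatives cancel.
  have key : ∀ (ψ : 𝓢(ℝ, ℂ)) (τ : ℝ),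
      (𝓕 (y τ) : 𝓢'(ℝ, ℂ)) (SchwartzMap.smulLeftCLM ℂ (planeWave P (-τ) 0) ψ) =
        (𝓕 (y 0) : 𝓢'(ℝ, ℂ)) ψ := by
    intro ψ
    set A := (SchwartzMap.smulLeftCLM ℂ (besselSymbol (-s)) ψ).toLp 2
    set a : ℝ → Lp ℂ 2 (volume : Measure ℝ) := fun τ => evolve P hP.continuous (-τ) A
    have hpair : ∀ τ σ, (𝓕 (y τ) : 𝓢'(ℝ, ℂ)) (SchwartzMap.smulLeftCLM ℂ (planeWave P (-σ) 0) ψ) =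
        pairL2 (a σ) (𝓕 (F τ)) := by
      intro τ σ
      rw [fourier_apply_of_besselOp (hyF τ), smulLeft_comm hw (hpw (-σ)), ← evolve_toLp hP]
    have hderiv : ∀ τ, HasDerivAt (fun σ => pairL2 (a σ) (𝓕 (F σ))) 0 τ := by
      intro τ
      set ψτ := SchwartzMap.smulLeftCLM ℂ (planeWave P (-τ) 0) ψ
      set a' : Lp ℂ 2 (volume : Measure ℝ) := (SchwartzMap.smulLeftCLM ℂ (genSymbol P)
        (SchwartzMap.smulLeftCLM ℂ (planeWave P (-τ) 0)
          (SchwartzMap.smulLeftCLM ℂ (besselSymbol (-s)) ψ))).toLp 2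
      have ha : HasDerivAt a (-a') τ := by
        have := (hasDerivAt_evolve_toLp hP (-τ)
          (SchwartzMap.smulLeftCLM ℂ (besselSymbol (-s)) ψ)).scomp τ (hasDerivAt_neg τ)
        simpa [Function.comp_def] using this
      have hweak : HasDerivAt (fun σ => pairL2 (a τ) (𝓕 (F σ))) (pairL2 a' (𝓕 (F τ))) τ := by
        have h1 := hy τ (𝓕 ψτ)
        rw [generator_apply_fourier, fourier_apply_of_besselOp (hyF τ), smulLeft_comm hw hg,
          smulLeft_comm hw (hpw (-τ))] at h1
        refine h1.congr_of_eventuallyEq (Eventually.of_forall fun σ => ?_)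
        exact (hpair σ τ).symm
      have h2 := hasDerivAt_bilinear_of_hasDerivAt_pairing pairL2 ha hFc.continuousAt hweak
      rwa [map_neg, neg_apply, neg_add_cancel] at h2
    intro τ
    have hconst := is_const_of_deriv_eq_zero (f := fun σ => pairL2 (a σ) (𝓕 (F σ)))
      (fun σ => (hderiv σ).differentiableAt) (fun σ => (hderiv σ).deriv) τ 0
    have h0 : SchwartzMap.smulLeftCLM ℂ (planeWave P (-0) 0) ψ = ψ := by
      ext ξ
      rw [SchwartzMap.smulLeftCLM_apply_apply (hpw _), neg_zero, planeWave_zero, one_smul]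
    rw [hpair τ τ, hconst, ← hpair 0 0, h0]
  ext φ
  have h1 := key (SchwartzMap.smulLeftCLM ℂ (planeWave P t 0) (𝓕⁻ φ)) t
  have h2 : SchwartzMap.smulLeftCLM ℂ (planeWave P (-t) 0)
      (SchwartzMap.smulLeftCLM ℂ (planeWave P t 0) (𝓕⁻ φ)) = 𝓕⁻ φ := by
    ext ξ
    rw [SchwartzMap.smulLeftCLM_apply_apply (hpw _), SchwartzMap.smulLeftCLM_apply_apply (hpw _),
      smul_smul, planeWave_add, neg_add_cancel, planeWave_zero, one_smul]
  rw [h2, TemperedDistribution.fourier_apply, fourier_fourierInv_eq] at h1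
  rw [h1, solution_apply]

/-! ### The concrete phase and the conclusion -/

/-- The phase function `β k ^ 3 - α k ^ 2 - δ k` at the angular frequency `k = 2 π ξ`. -/
noncomputable def phase (α β δ ξ : ℝ) : ℝ :=
  β * (2 * Real.pi * ξ) ^ 3 - α * (2 * Real.pi * ξ) ^ 2 - δ * (2 * Real.pi * ξ)

theorem hasTemperateGrowth_phase (α β δ : ℝ) : (phase α β δ).HasTemperateGrowth := by
  unfold phase; fun_prop

/-- The total phase is a cubic in `ξ` with leading coefficient `t β (2 π) ^ 3`. The van der Corput
bound ignores lower order terms, so `α`, `δ` and `x` do not enter the constant; `β > 0` is needed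
here. -/
theorem exists_dispersiveBound_phase (α δ : ℝ) {β : ℝ} (hβ : 0 < β) :
    ∃ D, 0 ≤ D ∧ DispersiveBound (phase α β δ) D := by
  refine ⟨20 * (β * (2 * Real.pi) ^ 3) ^ (-(1 / 3) : ℝ), by positivity, fun a b t x ht => ?_⟩
  have hB : 0 < β * (2 * Real.pi) ^ 3 := by positivity
  have h := norm_integral_cexp_cubic_le (A := t * (β * (2 * Real.pi) ^ 3))
    (mul_ne_zero ht hB.ne') (-(t * (α * (2 * Real.pi) ^ 2)))
    (2 * Real.pi * x - t * (δ * (2 * Real.pi))) a b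
  rw [abs_mul, abs_of_pos hB, Real.mul_rpow (abs_nonneg _) hB.le] at h
  refine le_trans (le_of_eq ?_) (h.trans (le_of_eq (by ring)))
  congr 1
  apply intervalIntegral.integral_congr
  intro ξ _
  simp only [planeWave, phase]
  congr 3
  ring

theorem dx_eq_fourierMultiplier (f : 𝓢'(ℝ, ℂ)) :
    dx f = TemperedDistribution.fourierMultiplierCLM ℂ
      (fun ξ : ℝ => Complex.I * ((2 * Real.pi * ξ : ℝ) : ℂ)) f := by
  have h : dx f = LineDeriv.lineDerivOp (1 : ℝ) f := by
    ext φ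
    rw [TemperedDistribution.lineDerivOp_apply_apply, dx,
      TemperedDistribution.derivCLM_apply_apply]
    congr 2
  have hg : (fun ξ : ℝ => ((inner ℝ ξ 1 : ℝ) : ℂ)).HasTemperateGrowth := by fun_prop
  rw [h, TemperedDistribution.lineDeriv_eq_fourierMultiplierCLM, ← smul_apply,
    ← TemperedDistribution.fourierMultiplierCLM_smul hg]
  congr 2
  ext ξ
  simp
  ring

/-- With `k = 2 π ξ` the symbols cancel: `i · i (β k³ - α k² - δ k) + i β (i k)³ + α (i k)² + i δ (i
k) = 0`. -/
theorem generator_phase (α β δ : ℝ) (f : 𝓢'(ℝ, ℂ)) :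
    Complex.I • generator (phase α β δ) f + (Complex.I * (β : ℂ)) • dx (dx (dx f))
      + (α : ℂ) • dx (dx f) + (Complex.I * (δ : ℂ)) • dx f = 0 := by
  ext φ
  set k : ℝ → ℂ := fun ξ : ℝ => Complex.I * ((2 * Real.pi * ξ : ℝ) : ℂ)
  have hk : k.HasTemperateGrowth := by simp only [k]; fun_prop
  have hg := hasTemperateGrowth_genSymbol (hasTemperateGrowth_phase α β δ)
  have hd1 : dx f = TemperedDistribution.fourierMultiplierCLM ℂ k f := dx_eq_fourierMultiplier f
  have hd2 : dx (dx f) = TemperedDistribution.fourierMultiplierCLM ℂ (k * k) f := by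
    rw [hd1, dx_eq_fourierMultiplier,
      TemperedDistribution.fourierMultiplierCLM_fourierMultiplierCLM_apply hk hk]
  have hd3 : dx (dx (dx f)) = TemperedDistribution.fourierMultiplierCLM ℂ (k * k * k) f := by
    rw [hd2, dx_eq_fourierMultiplier,
      TemperedDistribution.fourierMultiplierCLM_fourierMultiplierCLM_apply (hk.mul hk) hk]
  rw [hd3, hd2, hd1]
  have happ : ∀ a b c d : 𝓢'(ℝ, ℂ), (Complex.I • a + (Complex.I * (β : ℂ)) • b + (α : ℂ) • c +
      (Complex.I * (δ : ℂ)) • d) φ = Complex.I • a φ + (Complex.I * (β : ℂ)) • b φ +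
      (α : ℂ) • c φ + (Complex.I * (δ : ℂ)) • d φ := fun a b c d => rfl
  rw [happ, generator]
  simp only [TemperedDistribution.fourierMultiplierCLM_apply_apply]
  rw [← map_smul, ← map_smul, ← map_smul, ← map_smul, ← map_add, ← map_add, ← map_add,
    ← FourierTransform.fourier_smul, ← FourierTransform.fourier_smul,
    ← FourierTransform.fourier_smul, ← FourierTransform.fourier_smul,
    ← FourierTransform.fourier_add, ← FourierTransform.fourier_add, ← FourierTransform.fourier_add]
  have hz : Complex.I • SchwartzMap.smulLeftCLM ℂ (genSymbol (phase α β δ)) (𝓕⁻ φ) +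
      (Complex.I * (β : ℂ)) • SchwartzMap.smulLeftCLM ℂ (k * k * k) (𝓕⁻ φ) +
      (α : ℂ) • SchwartzMap.smulLeftCLM ℂ (k * k) (𝓕⁻ φ) +
      (Complex.I * (δ : ℂ)) • SchwartzMap.smulLeftCLM ℂ k (𝓕⁻ φ) = 0 := by
    ext ξ
    simp only [add_apply, smul_apply, zero_apply]
    rw [SchwartzMap.smulLeftCLM_apply_apply hg, SchwartzMap.smulLeftCLM_apply_apply hk,
      SchwartzMap.smulLeftCLM_apply_apply (hk.mul hk),
      SchwartzMap.smulLeftCLM_apply_apply ((hk.mul hk).mul hk)]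
    simp only [smul_eq_mul, genSymbol, phase, k, Pi.mul_apply]
    push_cast
    have hI4 : Complex.I ^ 4 = 1 := Complex.I_pow_four
    ring_nf
    simp [hI4, Complex.I_sq]
  rw [hz]
  simp

theorem isCauchySolution_solution (α β δ s : ℝ) {y₀ : 𝓢'(ℝ, ℂ)} (h : MemBessel s 2 y₀) :
    IsCauchySolution α β δ s y₀ fun t => solution (phase α β δ) t y₀ where
  continuousInSobolev := continuousInSobolev_solution (hasTemperateGrowth_phase α β δ) h
  equation := ⟨fun t => generator (phase α β δ) (solution (phase α β δ) t y₀),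
    hasDerivAt_solution_apply (hasTemperateGrowth_phase α β δ) h,
    fun t => generator_phase α β δ _⟩
  initial := by
    have : planeWave (phase α β δ) 0 0 = fun _ => 1 := funext fun ξ => planeWave_zero _ ξ
    simp [solution, this]

theorem IsCauchySolution.eq_solution {α β δ s : ℝ} {y₀ : 𝓢'(ℝ, ℂ)} {y : ℝ → 𝓢'(ℝ, ℂ)}
    (h : IsCauchySolution α β δ s y₀ y) : y = fun t => solution (phase α β δ) t y₀ := by
  obtain ⟨y', hy', heq⟩ := h.equation
  have hgen : ∀ t, y' t = generator (phase α β δ) (y t) := by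
    intro t
    have h1 := (heq t).trans (generator_phase α β δ (y t)).symm
    simp only [add_left_inj] at h1
    exact smul_right_injective _ Complex.I_ne_zero h1
  ext1 t
  rw [← h.initial]
  refine eq_solution_of_hasDerivAt (hasTemperateGrowth_phase α β δ) h.continuousInSobolev
    (fun t φ => ?_) t
  rw [← hgen]
  exact hy' t φ

/-- `L²` embeds injectively in tempered distributions, so the infimum runs over a single
representative. -/
theorem enorm_le_besselENorm {s : ℝ} {y₀ : 𝓢'(ℝ, ℂ)} {g : Lp ℂ 2 (volume : Measure ℝ)}
    (hg : besselOp s y₀ = (g : 𝓢'(ℝ, ℂ))) : ‖g‖ₑ ≤ besselENorm s 2 y₀ := by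
  refine le_iInf₂ fun g' hg' => le_of_eq ?_
  have hinj := LinearMap.ker_eq_bot.1 (Lp.ker_toTemperedDistributionCLM_eq_bot
    (F := ℂ) (μ := (volume : Measure ℝ)) (p := 2))
  rw [hinj (hg.symm.trans hg' : Lp.toTemperedDistribution g = Lp.toTemperedDistribution g')]

theorem theorem2p2 (α β δ : ℝ) (hβ : 0 < β) (s : ℝ) (μ r : ℝ≥0∞) [Fact (1 ≤ r)]
    (hμr : IsAdmissiblePair μ r) :
    ∃ C : ℝ≥0, ∀ y₀ : 𝓢'(ℝ, ℂ), MemBessel s 2 y₀ →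
      (∃! y : ℝ → 𝓢'(ℝ, ℂ), IsCauchySolution α β δ s y₀ y) ∧
      ∀ y : ℝ → 𝓢'(ℝ, ℂ), IsCauchySolution α β δ s y₀ y →
        ∀ T : ℝ, 0 < T →
          MemBochnerBessel T μ s r y ∧
          bochnerBesselENorm T μ s r y ≤ C * besselENorm s 2 y₀ := by
  have hP := hasTemperateGrowth_phase α β δ
  obtain ⟨D, hD0, hD⟩ := exists_dispersiveBound_phase α δ hβ
  obtain ⟨C, hC⟩ := exists_strichartz hP.continuous hD0 hD hμr
  refine ⟨C, fun y₀ hy₀ => ⟨⟨_, isCauchySolution_solution α β δ s hy₀,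
    fun y hy => hy.eq_solution⟩, fun y hy T _ => ?_⟩⟩
  obtain ⟨g, hg⟩ := hy₀
  -- The estimate takes its datum on the Fourier side; Plancherel later turns `‖𝓕 g‖` back into
  -- `‖g‖`.
  obtain ⟨G, hG, hGle, hGeq⟩ := hC T (𝓕 g)
  have hrep : ∀ᵐ t ∂(volume.restrict (Set.Ioo 0 T)), besselOp s (y t) = (G t : 𝓢'(ℝ, ℂ)) := by
    filter_upwards [hGeq] with t ht
    rw [hy.eq_solution, besselOp_solution_eq hP hg, ht]
  refine ⟨⟨G, hG, hrep⟩, ?_⟩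
  calc bochnerBesselENorm T μ s r y ≤ eLpNorm G μ (volume.restrict (Set.Ioo 0 T)) := by
        refine eLpNorm_mono_enorm_ae ?_
        filter_upwards [hrep] with t ht
        exact iInf₂_le (G t) ht
    _ ≤ C * ‖(𝓕 g : Lp ℂ 2 (volume : Measure ℝ))‖ₑ := hGle
    _ = C * ‖g‖ₑ := by rw [← ofReal_norm, Lp.norm_fourier_eq, ofReal_norm]
    _ ≤ C * besselENorm s 2 y₀ := by gcongr; exact enorm_le_besselENorm hg
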